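/- Let $A\in\mathbb R^{n\times n}$ be neutrally stable, i.e. every eigenvalue $\mu$ of $A$ satisfies $|\mu|\le 1$ and every Jordan block of an eigenvalue with $|\mu|=1$ has size one. Let $C\in\mathbb R^{m\times n}$ be such that $(C,A)$ is detectable, i.e. $CA^kx=0$ for all $k\in\mathbb N$ implies $A^kx\to 0$ as $k\to\infty$. A gain $L\in\mathbb R^{n\times m}$ is built as follows. Let $n_1$ be the number of eigenvalues of $A$ of magnitude one, counted with algebraic multiplicity, and $n_2=n-n_1$. If $n_1=0$, put $L=0$. Otherwise: (1) choose $U\in\mathbb R^{n\times n_1}$, $W\in\mathbb R^{n\times n_2}$ with $[U\ W]$ invertible and $[U\ W]^{-1}A[U\ W]=\begin{bmatrix}F&0\\0&G\end{bmatrix}$, where all eigenvalues of $F\in\mathbb R^{n_1\times n_1}$ have magnitude one; if $CU$ does not have full row rank, replace the output $y$ by a reduced output $Ty$, where $T\in\mathbb R^{q\times m}$ and $\operatorname{rank}(TCU)=\operatorname{rank}(CU)=q$ (if $CU$ has full row rank, one may take $T=I_m$); (2) choose a symmetric positive definite $R\in\mathbb R^{n_1\times n_1}$ with $F^TRF=R$;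 (3) choose $H\in\mathbb R^{q\times n_1}$ with $\operatorname{range}(H^T)=\operatorname{range}(R^{-1/2}U^T(TC)^T)$ and $HH^T=I_q$; (4) put $L=UFR^{-1/2}H^T\,(TCUR^{-1/2}H^T)^{-1}\,T$. Then such an $L$ exists, and every $L$ built in this way has the following property. Let $p\in\mathbb N$ and let $\Lambda=[\lambda_{ij}]\in\mathbb R^{p\times p}$ be any connected matrix, i.e. $\lambda_{ii}>0$ and $\lambda_{ij}\ge 0$ for all $i,j$, each row sum equals $1$, and the directed graph on $\{1,\dots,p\}$ with an arc $(i,j)$ whenever $\lambda_{ij}>0$ has a node to which there is a path from every other node. Then there is exactly one $r\in\mathbb R^p$ with $r^T\Lambda=r^T$ and $\sum_i r_i=1$, and for all initial states the solutions $x_i:\mathbb N\to\mathbb R^n$, $i=1,\dots,p$, of the coupled systems $$x_i^+=Ax_i+L\sum_{j=1}^p\lambda_{ij}(y_j-y_i),\qquad y_i=Cx_i,$$ synchronize to $\bar x(k)=(r^T\otimes A^k)\,[x_1(0)^T\ \cdots\ x_p(0)^T]^T$, i.e. $|x_i(k)-\bar x(k)|\to 0$ as $k\to\infty$ for every $i$.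 -/

import Mathlib

open Filter Topology
open scoped Matrix

noncomputable section

/-- `μ : ℂ` is an eigenvalue of the real square matrix `A`. -/
def IsEigenvalue {n : ℕ} (A : Matrix (Fin n) (Fin n) ℝ) (μ : ℂ) : Prop :=
  Module.End.HasEigenvalue (Matrix.toLin' (A.map (algebraMap ℝ ℂ))) μ

/-- Neutral stability (discrete time): no eigenvalue has magnitude greater than one, and every
Jordan block of an eigenvalue of magnitude one has size one, i.e. the generalized eigenspace
of such an eigenvalue is just its eigenspace. -/
def NeutrallyStable {n : ℕ} (A : Matrix (Fin n) (Fin n) ℝ) : Prop :=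
  ∀ μ : ℂ, IsEigenvalue A μ → ‖μ‖ ≤ 1 ∧
    (‖μ‖ = 1 →
      Module.End.maxGenEigenspace (Matrix.toLin' (A.map (algebraMap ℝ ℂ))) μ =
        Module.End.eigenspace (Matrix.toLin' (A.map (algebraMap ℝ ℂ))) μ)

/-- Detectability of the pair `(C, A)` (discrete time). -/
def Detectable {n m : ℕ} (C : Matrix (Fin m) (Fin n) ℝ) (A : Matrix (Fin n) (Fin n) ℝ) : Prop :=
  ∀ x : Fin n → ℝ, (∀ k : ℕ, (C * A ^ k) *ᵥ x = 0) →
    Tendsto (fun k : ℕ => (A ^ k) *ᵥ x) atTop (𝓝 0)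

/-- The number of eigenvalues of `A` of magnitude one, counted with algebraic multiplicity. -/
def numUnitEigenvalues {n : ℕ} (A : Matrix (Fin n) (Fin n) ℝ) : ℕ :=
  Multiset.card ((A.map (algebraMap ℝ ℂ)).charpoly.roots.filter (fun μ : ℂ => ‖μ‖ = 1))

/-- Step 1: `[U W]` is invertible, `[U W]⁻¹ A [U W]` is block diagonal with blocks `F` and `G`,
and all eigenvalues of `F` have magnitude one. -/
def IsUnitSplitting {n n₁ n₂ : ℕ} (A : Matrix (Fin n) (Fin n) ℝ)
    (U : Matrix (Fin n) (Fin n₁) ℝ) (W : Matrix (Fin n) (Fin n₂) ℝ)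
    (F : Matrix (Fin n₁) (Fin n₁) ℝ) (G : Matrix (Fin n₂) (Fin n₂) ℝ) : Prop :=
  (∃ V : Matrix (Fin n₁ ⊕ Fin n₂) (Fin n) ℝ,
    V * Matrix.fromCols U W = 1 ∧ Matrix.fromCols U W * V = 1 ∧
    V * A * Matrix.fromCols U W = Matrix.fromBlocks F 0 0 G) ∧
  ∀ μ : ℂ, IsEigenvalue F μ → ‖μ‖ = 1

/-- Step 2: `R` is symmetric positive definite with `Fᵀ R F = R`. The matrix `S` is its
(unique) symmetric positive definite square root `R^(1/2)`, so that `S⁻¹ = R^(-1/2)`. -/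
def IsInvariantForm {n₁ : ℕ} (F R S : Matrix (Fin n₁) (Fin n₁) ℝ) : Prop :=
  R.PosDef ∧ Fᵀ * R * F = R ∧ S.PosDef ∧ S * S = R

/-- Step 3, for the output matrix `C`: the rows of `H` are orthonormal, and the range of `Hᵀ`
is the range of `R^(-1/2) Uᵀ Cᵀ`, where `S = R^(1/2)`. -/
def IsOutputBasis {n m n₁ : ℕ} (C : Matrix (Fin m) (Fin n) ℝ) (U : Matrix (Fin n) (Fin n₁) ℝ)
    (S : Matrix (Fin n₁) (Fin n₁) ℝ) (H : Matrix (Fin m) (Fin n₁) ℝ) : Prop :=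
  LinearMap.range Hᵀ.mulVecLin = LinearMap.range (S⁻¹ * Uᵀ * Cᵀ).mulVecLin ∧ H * Hᵀ = 1

/-- `L` is a possible outcome of the algorithm for the pair `(C, A)`.

The algorithm asks for `C U` to have full row rank. In general this is achieved by passing from
the output `y` to a reduced output `T y`, with `T C U` of full row rank and of the same rank
as `C U`; the algorithm is run with the output matrix `T C`, and the gain it returns is applied
to `T y`. If `C U` has full row rank, then `T = 1` is allowed, and this is the algorithm
for `C` itself. -/
def IsAlgorithmGain {n m : ℕ} (A : Matrix (Fin n) (Fin n) ℝ) (C : Matrix (Fin m) (Fin n) ℝ)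
    (L : Matrix (Fin n) (Fin m) ℝ) : Prop :=
  (numUnitEigenvalues A = 0 ∧ L = 0) ∨
  (numUnitEigenvalues A ≠ 0 ∧
    ∃ (U : Matrix (Fin n) (Fin (numUnitEigenvalues A)) ℝ)
      (W : Matrix (Fin n) (Fin (n - numUnitEigenvalues A)) ℝ)
      (F : Matrix (Fin (numUnitEigenvalues A)) (Fin (numUnitEigenvalues A)) ℝ)
      (G : Matrix (Fin (n - numUnitEigenvalues A)) (Fin (n - numUnitEigenvalues A)) ℝ)
      (q : ℕ) (T : Matrix (Fin q) (Fin m) ℝ)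
      (R S : Matrix (Fin (numUnitEigenvalues A)) (Fin (numUnitEigenvalues A)) ℝ)
      (H : Matrix (Fin q) (Fin (numUnitEigenvalues A)) ℝ),
      IsUnitSplitting A U W F G ∧
      (T * C * U).rank = q ∧ (C * U).rank = q ∧
      IsInvariantForm F R S ∧
      IsOutputBasis (T * C) U S H ∧
      L = (U * F * S⁻¹ * Hᵀ * (T * C * U * S⁻¹ * Hᵀ)⁻¹) * T)

/-- `Λ` is connected (discrete time): positive diagonal and nonnegative entries, unit row sums,
and in the graph with an arc from `i` to `j` whenever `Λ i j > 0` there is a node to which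
there is a path from every other node. -/
def ConnectedMatrix {p : ℕ} (Λ : Matrix (Fin p) (Fin p) ℝ) : Prop :=
  (∀ i, 0 < Λ i i) ∧ (∀ i j, 0 ≤ Λ i j) ∧ (∀ i, ∑ j, Λ i j = 1) ∧
  ∃ root : Fin p, ∀ i : Fin p, Relation.ReflTransGen (fun a b => 0 < Λ a b) i root

/-- `rᵀ Λ = rᵀ` and `rᵀ 1 = 1`. -/
def IsNormalizedLeftFixed {p : ℕ} (Λ : Matrix (Fin p) (Fin p) ℝ) (r : Fin p → ℝ) : Prop :=
  r ᵥ* Λ = r ∧ ∑ i, r i = 1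

/-- The signal `z i = ∑ j, Λ i j (y j - y i)`. -/
def couplingSignal {p m : ℕ} (Λ : Matrix (Fin p) (Fin p) ℝ) (y : Fin p → Fin m → ℝ)
    (i : Fin p) : Fin m → ℝ :=
  ∑ j, Λ i j • (y j - y i)

/-- `x i k` (the state of system `i` at time `k`) solves `xᵢ⁺ = A xᵢ + L zᵢ`, `yᵢ = C xᵢ`. -/
def IsSolution {p n m : ℕ} (A : Matrix (Fin n) (Fin n) ℝ) (C : Matrix (Fin m) (Fin n) ℝ)
    (L : Matrix (Fin n) (Fin m) ℝ) (Λ : Matrix (Fin p) (Fin p) ℝ)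
    (x : Fin p → ℕ → Fin n → ℝ) : Prop :=
  ∀ i k, x i (k + 1) = A *ᵥ x i k + L *ᵥ couplingSignal Λ (fun j => C *ᵥ x j k) i

/-- The maps `ξ i` synchronize to `ξbar`: the Euclidean norm of the difference tends to zero. -/
def SynchronizeTo {p n : ℕ} (ξ : Fin p → ℕ → Fin n → ℝ) (ξbar : ℕ → Fin n → ℝ) : Prop :=
  ∀ i, Tendsto (fun k => ‖WithLp.toLp 2 (ξ i k - ξbar k)‖) atTop (𝓝 0)

/-- The trajectory `(rᵀ ⊗ A^k) [x₁(0); …; x_p(0)]`. -/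
def consensusTrajectory {p n : ℕ} (r : Fin p → ℝ) (A : Matrix (Fin n) (Fin n) ℝ)
    (x₀ : Fin p → Fin n → ℝ) (k : ℕ) : Fin n → ℝ :=
  fun a => (Matrix.kronecker (Matrix.replicateRow Unit r) (A ^ k) *ᵥ
    (fun s : Fin p × Fin n => x₀ s.1 s.2)) ((), a)

end

/-!
Write `x̄(k) = ∑ rᵢ xᵢ(k)`. Since `rᵀ Λ = rᵀ`, the coupling does not act on this mean, so `x̄` is the
consensus trajectory, and the errors `xᵢ - x̄` evolve by `M = I ⊗ A + (Λ - I) ⊗ L C` on the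
space `X` of tuples of weighted mean zero. It is enough that the eigenvalues of `M` on `X` lie in
the open unit disc (Gelfand's formula). As `M` commutes with `Λ ⊗ I`, every eigenvalue `μ` of `M`
on `X` has an eigenvector in `X` that is also an eigenvector of `Λ ⊗ I`, for an eigenvalue `ν` of
`Λ`. For a connected matrix, a maximum principle (`ConnectedMatrix.exists_maximum`) shows that the
fixed vectors are the constants, which meet `X` only in zero, and that all eigenvalues other
than `1` have modulus less than one. Hence `‖ν‖ < 1`, and `μ` is an eigenvalue of
`A + (ν - 1) L C` (`ConnectedMatrix.norm_lt_one_of_coupledMap_eq_smul`). The same maximum principle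
gives the left fixed vector `r` and its uniqueness.

It remains to see that `A + (ν - 1) L C` is Schur stable for `‖ν‖ < 1`
(`norm_lt_one_of_closedLoop`). The range of `L` lies in that of `U`, so the complementary block is
`G`, which is Schur stable because `F` accounts for all unit eigenvalues. On the range of `U` the
map is `ξ ↦ F (ξ + (ν - 1) S⁻¹ Hᵀ H S ξ)`; in the norm `‖S ξ‖`, which `F` preserves, it replaces the
component `Hᵀ H S ξ` of `S ξ` by `ν` times itself. This loses energy unless `H S ξ = 0`
(`mulVec_eq_zero_of_energy`), and then `U ξ` is an eigenvector of `A` with zero output, so that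
detectability gives the claim.

For the existence of `L`, the characteristic polynomial factors over `ℝ` into a part with roots on
the unit circle and a part with roots off it, and the kernels of the two factors at `A` split the
space (`exists_isUnitSplitting`). Neutral stability makes `F` diagonalizable over `ℂ`, and the
real part of the Hermitian form that makes an eigenbasis orthonormal is invariant
(`exists_posDef_invariant`).
-/

/-! ### Powers of a linear map whose eigenvalues have modulus less than one -/

/-- By Gelfand's formula, the powers of an endomorphism of a finite-dimensional complex space
tend to zero in norm as soon as all its eigenvalues lie in the open unit disc. -/
theorem Module.End.tendsto_pow_apply_zero {E : Type*} [NormedAddCommGroup E] [NormedSpace ℂ E]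
    [FiniteDimensional ℂ E] (f : Module.End ℂ E) (hf : ∀ μ : ℂ, f.HasEigenvalue μ → ‖μ‖ < 1)
    (x : E) : Tendsto (fun k : ℕ => (f ^ k) x) atTop (𝓝 0) := by
  cases subsingleton_or_nontrivial E
  · exact tendsto_const_nhds.congr fun k => Subsingleton.elim _ _
  have : CompleteSpace E := FiniteDimensional.complete ℂ E
  let e : Module.End ℂ E ≃ₐ[ℂ] (E →L[ℂ] E) := Module.End.toContinuousLinearMap E
  let a : E →L[ℂ] E := e f
  have hspec : spectrum ℂ a = spectrum ℂ f := AlgEquiv.spectrum_eq e f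
  have hρ : spectralRadius ℂ a < 1 := by
    obtain ⟨μ, hμ, hr⟩ := spectrum.exists_nnnorm_eq_spectralRadius a
    rw [← hr]
    rw [hspec, ← Module.End.hasEigenvalue_iff_mem_spectrum] at hμ
    have h := hf μ hμ
    rw [← coe_nnnorm] at h
    exact_mod_cast h
  obtain ⟨c, hac, hc⟩ := ENNReal.lt_iff_exists_nnreal_btwn.mp hρ
  have hev := (spectrum.pow_nnnorm_pow_one_div_tendsto_nhds_spectralRadius a).eventually_lt_const hac
  have hbound : ∀ᶠ k : ℕ in atTop, ‖(f ^ k) x‖ ≤ (c : ℝ) ^ k * ‖x‖ := by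
    filter_upwards [hev, eventually_gt_atTop 0] with k hk hk0
    have h1 : (‖a ^ k‖₊ : ENNReal) ≤ (c : ENNReal) ^ k := by
      have h2 := ENNReal.rpow_le_rpow hk.le (Nat.cast_nonneg (α := ℝ) k)
      have hk' : (k : ℝ) ≠ 0 := by positivity
      rwa [← ENNReal.rpow_mul, one_div, inv_mul_cancel₀ hk', ENNReal.rpow_one,
        ENNReal.rpow_natCast] at h2
    have h3 : ‖a ^ k‖ ≤ (c : ℝ) ^ k := by exact_mod_cast h1
    have h4 : (a ^ k) x = (f ^ k) x := by
      have : a ^ k = e (f ^ k) := (map_pow e f k).symm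
      rw [this]; rfl
    rw [← h4]
    exact ((a ^ k).le_opNorm x).trans (by gcongr)
  refine squeeze_zero_norm' hbound ?_
  have hc1 : (c : ℝ) < 1 := by exact_mod_cast hc
  simpa using (tendsto_pow_atTop_nhds_zero_of_lt_one c.coe_nonneg hc1).mul_const ‖x‖

/-- The powers of `f` tend to zero on an invariant subspace that contains only eigenvectors for
eigenvalues in the open unit disc. -/
theorem Module.End.tendsto_pow_apply_zero_of_mem {E : Type*} [NormedAddCommGroup E]
    [NormedSpace ℂ E] [FiniteDimensional ℂ E] (f : Module.End ℂ E) (X : Submodule ℂ E)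
    (hX : ∀ x ∈ X, f x ∈ X)
    (hf : ∀ (μ : ℂ) (x : E), x ∈ X → x ≠ 0 → f x = μ • x → ‖μ‖ < 1) {x : E} (hx : x ∈ X) :
    Tendsto (fun k : ℕ => (f ^ k) x) atTop (𝓝 0) := by
  have h := Module.End.tendsto_pow_apply_zero (f.restrict hX) (fun μ hμ => by
    obtain ⟨v, hv⟩ := hμ.exists_hasEigenvector
    refine hf μ v v.2 (fun h0 => hv.2 (Subtype.ext h0)) ?_
    simpa using congrArg Subtype.val hv.apply_eq_smul) ⟨x, hx⟩
  have h' := (continuous_subtype_val.tendsto _).comp h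
  refine h'.congr fun k => ?_
  rw [Function.comp_apply, Module.End.pow_restrict k hX]
  rfl

/-! ### Connected matrices -/

section Connected

variable {p : ℕ} {Λ : Matrix (Fin p) (Fin p) ℝ}

/-- If `w` is a probability vector and the weighted mean of the `x j` has at least the modulus
of each of them, then all `x j` of positive weight coincide with the mean: their variance is not
positive. -/
theorem eq_mean_of_norm_le_norm_mean {w : Fin p → ℝ} (hw : ∀ j, 0 ≤ w j) (hw1 : ∑ j, w j = 1)
    {x : Fin p → ℂ} {c : ℂ} (hc : ∑ j, (w j : ℂ) * x j = c) (hx : ∀ j, ‖x j‖ ≤ ‖c‖) {j : Fin p}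
    (hj : 0 < w j) : x j = c := by
  have key : ∑ j, w j * Complex.normSq (x j - c) =
      ∑ j, w j * (Complex.normSq (x j) - Complex.normSq c) := by
    have h1 : ∑ j, w j * ((x j) * (starRingEnd ℂ) c).re = Complex.normSq c := by
      have h2 : ∑ j, (w j : ℂ) * (x j * (starRingEnd ℂ) c) = (Complex.normSq c : ℂ) := by
        rw [← Complex.mul_conj, ← hc, Finset.sum_mul]
        exact Finset.sum_congr rfl fun j _ => by ring
      have := congrArg Complex.re h2
      rw [Complex.re_sum] at this
      simpa only [Complex.re_ofReal_mul, Complex.ofReal_re] using this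
    have h3 : ∀ j, w j * Complex.normSq (x j - c) =
        w j * (Complex.normSq (x j) - Complex.normSq c) +
          2 * (w j * Complex.normSq c - w j * ((x j) * (starRingEnd ℂ) c).re) := fun j => by
      rw [Complex.normSq_sub]; ring
    simp_rw [h3]
    rw [Finset.sum_add_distrib, ← Finset.mul_sum, Finset.sum_sub_distrib, h1, ← Finset.sum_mul,
      hw1]
    ring
  have hle : ∀ j, w j * (Complex.normSq (x j) - Complex.normSq c) ≤ 0 := fun j => by
    refine mul_nonpos_of_nonneg_of_nonpos (hw j) ?_
    rw [Complex.normSq_eq_norm_sq, Complex.normSq_eq_norm_sq, sub_nonpos]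
    exact pow_le_pow_left₀ (norm_nonneg _) (hx j) 2
  have h0 : ∑ j, w j * Complex.normSq (x j - c) = 0 :=
    le_antisymm (key ▸ Finset.sum_nonpos fun j _ => hle j)
      (Finset.sum_nonneg fun j _ => mul_nonneg (hw j) (Complex.normSq_nonneg _))
  have h4 := (Finset.sum_eq_zero_iff_of_nonneg
    (fun j _ => mul_nonneg (hw j) (Complex.normSq_nonneg _))).mp h0 j (Finset.mem_univ j)
  rcases mul_eq_zero.mp h4 with h | h
  · exact absurd h hj.ne'
  · exact sub_eq_zero.mp (Complex.normSq_eq_zero.mp h)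

/-- Maximum principle: an eigenvector of a connected matrix for an eigenvalue outside the open
unit disc attains its largest modulus at the root, and the eigenvalue is `1`. -/
theorem ConnectedMatrix.exists_maximum (hΛ : ConnectedMatrix Λ) :
    ∃ root : Fin p, ∀ (x : Fin p → ℂ) (μ : ℂ), (∀ i, ∑ j, (Λ i j : ℂ) * x j = μ * x i) →
      1 ≤ ‖μ‖ → x ≠ 0 → μ = 1 ∧ x root ≠ 0 := by
  obtain ⟨hdiag, hnn, hsum, root, hroot⟩ := hΛ
  refine ⟨root, fun x μ hx hμ hx0 => ?_⟩
  obtain ⟨i, -, hi⟩ := Finset.exists_max_image Finset.univ (fun j => ‖x j‖)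
    ⟨root, Finset.mem_univ _⟩
  have hi0 : x i ≠ 0 := fun h => hx0 <| funext fun j => by
    simpa [h] using hi j (Finset.mem_univ j)
  have step : ∀ a b, (∀ j, ‖x j‖ ≤ ‖x a‖) → 0 < Λ a b → x b = μ * x a := fun a b ha hab =>
    eq_mean_of_norm_le_norm_mean (hnn a) (hsum a) (hx a) (fun j => (ha j).trans (by
      rw [norm_mul]; exact le_mul_of_one_le_left (norm_nonneg _) hμ)) hab
  have hi' : ∀ j, ‖x j‖ ≤ ‖x i‖ := fun j => hi j (Finset.mem_univ j)
  have hμ1 : μ = 1 := by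
    have := step i i hi' (hdiag i)
    exact (mul_right_cancel₀ hi0 (by rw [one_mul]; exact this)).symm
  refine ⟨hμ1, ?_⟩
  have hpath := hroot i
  have : x root = x i := by
    clear hroot
    induction hpath with
    | refl => rfl
    | tail _ hbc ih => rw [step _ _ (by rwa [ih]) hbc, hμ1, one_mul, ih]
  rwa [this]

theorem ConnectedMatrix.norm_eigenvalue_lt_one (hΛ : ConnectedMatrix Λ) {x : Fin p → ℂ} {μ : ℂ}
    (hx : ∀ i, ∑ j, (Λ i j : ℂ) * x j = μ * x i) (hx0 : x ≠ 0) (hμ : μ ≠ 1) : ‖μ‖ < 1 := by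
  obtain ⟨root, h⟩ := hΛ.exists_maximum
  by_contra! hle
  exact hμ (h x μ hx hle hx0).1

/-- The fixed vectors of a connected matrix are constant: after subtraction of its value at the
root, a fixed vector vanishes at the root, hence everywhere. -/
theorem ConnectedMatrix.eq_of_fixed (hΛ : ConnectedMatrix Λ) {x : Fin p → ℂ}
    (hx : ∀ i, ∑ j, (Λ i j : ℂ) * x j = x i) (i j : Fin p) : x i = x j := by
  obtain ⟨root, h⟩ := hΛ.exists_maximum
  have hsum : ∀ i, ∑ j, (Λ i j : ℂ) = 1 := fun i => by exact_mod_cast hΛ.2.2.1 i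
  have h0 : (fun i => x i - x root) = 0 := by
    by_contra hne
    refine (h (fun i => x i - x root) 1 (fun i => ?_) (by simp) hne).2 (sub_self _)
    simp [mul_sub, Finset.sum_sub_distrib, hx, ← Finset.sum_mul, hsum]
  have hi := congrFun h0 i
  have hj := congrFun h0 j
  simp only [Pi.zero_apply, sub_eq_zero] at hi hj
  rw [hi, hj]

theorem ConnectedMatrix.ker_sub_one_le (hΛ : ConnectedMatrix Λ) :
    LinearMap.ker (Λ - 1).mulVecLin ≤ Submodule.span ℝ {(1 : Fin p → ℝ)} := by
  intro x hx
  obtain ⟨root, -⟩ := hΛ.2.2.2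
  have hx' : Λ *ᵥ x = x := by
    simpa [Matrix.sub_mulVec, sub_eq_zero] using hx
  rw [Submodule.mem_span_singleton]
  refine ⟨x root, funext fun i => ?_⟩
  have := hΛ.eq_of_fixed (x := fun i => (x i : ℂ)) (fun i => by
    have h := congrFun hx' i
    simp only [Matrix.mulVec, dotProduct] at h
    exact_mod_cast h) root i
  simpa using this

/-- `Λ x = x + 1` is impossible at an entry where `x` is maximal. -/
theorem ConnectedMatrix.one_notMem_range (hΛ : ConnectedMatrix Λ) :
    (1 : Fin p → ℝ) ∉ LinearMap.range (Λ - 1).mulVecLin := by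
  rintro ⟨x, hx⟩
  obtain ⟨-, hnn, hsum, root, -⟩ := hΛ
  obtain ⟨i, -, hi⟩ := Finset.exists_max_image Finset.univ x ⟨root, Finset.mem_univ _⟩
  have h : ∑ j, Λ i j * x j - x i = 1 := by
    simpa [Matrix.sub_mulVec, Matrix.mulVec, dotProduct] using congrFun hx i
  have h2 : ∑ j, Λ i j * x j ≤ ∑ j, Λ i j * x i :=
    Finset.sum_le_sum fun j hj => mul_le_mul_of_nonneg_left (hi j hj) (hnn i j)
  rw [← Finset.sum_mul, hsum, one_mul] at h2
  linarith

theorem vecMul_eq_self_iff {r : Fin p → ℝ} :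
    r ᵥ* Λ = r ↔ ∀ x, r ⬝ᵥ ((Λ - 1).mulVecLin x) = 0 := by
  have h : ∀ x, r ⬝ᵥ ((Λ - 1).mulVecLin x) = (r ᵥ* Λ - r) ⬝ᵥ x := fun x => by
    simp [Matrix.dotProduct_mulVec]
  simp_rw [h]
  constructor
  · intro hr x
    rw [hr, sub_self, zero_dotProduct]
  · intro hr
    exact sub_eq_zero.mp (dotProduct_eq_zero _ hr)

/-- The space is the direct sum of the range of `Λ - 1` and of the constant vectors, so a
functional that vanishes on the former is determined by its value at the vector of ones. -/
theorem ConnectedMatrix.existsUnique_leftFixed (hΛ : ConnectedMatrix Λ) :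
    ∃! r : Fin p → ℝ, IsNormalizedLeftFixed Λ r := by
  have h1 := hΛ.one_notMem_range
  have hsup : LinearMap.range (Λ - 1).mulVecLin ⊔ Submodule.span ℝ {(1 : Fin p → ℝ)} = ⊤ := by
    have hdisj : Disjoint (LinearMap.range (Λ - 1).mulVecLin)
        (Submodule.span ℝ {(1 : Fin p → ℝ)}) :=
      (Submodule.disjoint_span_singleton_of_notMem h1)
    apply Submodule.eq_top_of_finrank_eq
    refine le_antisymm (Submodule.finrank_le _) ?_
    have e1 := Submodule.finrank_sup_add_finrank_inf_eq
      (LinearMap.range (Λ - 1).mulVecLin) (Submodule.span ℝ {(1 : Fin p → ℝ)})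
    rw [hdisj.eq_bot, finrank_bot] at e1
    have e2 := LinearMap.finrank_range_add_finrank_ker (Λ - 1).mulVecLin
    have e3 := Submodule.finrank_mono hΛ.ker_sub_one_le
    omega
  obtain ⟨φ, hφ1, hφ⟩ := Submodule.exists_le_ker_of_notMem h1
  have hφr : ∀ x, φ x = (fun i => φ (Pi.single i 1)) ⬝ᵥ x := fun x => by
    conv_lhs => rw [pi_eq_sum_univ' x]
    simp [dotProduct, mul_comm]
  refine ⟨(φ 1)⁻¹ • fun i => φ (Pi.single i 1), ⟨?_, ?_⟩, fun s hs => ?_⟩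
  · rw [vecMul_eq_self_iff]
    intro x
    rw [smul_dotProduct, ← hφr, LinearMap.mem_ker.mp (hφ ⟨x, rfl⟩), smul_zero]
  · have := hφr 1
    rw [dotProduct_one] at this
    simp only [Pi.smul_apply, smul_eq_mul]
    rw [← Finset.mul_sum, ← this, inv_mul_cancel₀ hφ1]
  · obtain ⟨hs1, hs2⟩ := hs
    rw [vecMul_eq_self_iff] at hs1
    refine dotProduct_eq _ _ fun x => ?_
    rw [smul_dotProduct, ← hφr]
    have hx : x ∈ LinearMap.range (Λ - 1).mulVecLin ⊔ Submodule.span ℝ {(1 : Fin p → ℝ)} :=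
      hsup ▸ Submodule.mem_top
    obtain ⟨_, ⟨y, rfl⟩, z, hz, rfl⟩ := Submodule.mem_sup.mp hx
    obtain ⟨c, rfl⟩ := Submodule.mem_span_singleton.mp hz
    rw [dotProduct_add, hs1, map_add, LinearMap.mem_ker.mp (hφ ⟨y, rfl⟩), dotProduct_smul,
      dotProduct_one, hs2, map_smul]
    simp only [zero_add, smul_eq_mul, mul_one]
    field_simp

end Connected

/-! ### The coupled dynamics -/

section Coupled

variable {n p : ℕ}

/-- The operator `Λ ⊗ I` on `p`-tuples of complex vectors. -/
noncomputable def mixingMap (n : ℕ) (Λ : Matrix (Fin p) (Fin p) ℝ) :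
    Module.End ℂ (Fin p → Fin n → ℂ) where
  toFun x i := ∑ j, (Λ i j : ℂ) • x j
  map_add' x y := by
    ext i : 1
    simp [smul_add, Finset.sum_add_distrib]
  map_smul' c x := by
    ext i : 1
    simp [Finset.smul_sum, smul_comm c]

/-- The operator `I ⊗ A + (Λ - I) ⊗ K` on `p`-tuples of complex vectors. -/
noncomputable def coupledMap (A K : Matrix (Fin n) (Fin n) ℂ) (Λ : Matrix (Fin p) (Fin p) ℝ) :
    Module.End ℂ (Fin p → Fin n → ℂ) where
  toFun x i := A *ᵥ x i + K *ᵥ (mixingMap n Λ x i - x i)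
  map_add' x y := by
    ext i : 1
    simp only [map_add, Pi.add_apply, Matrix.mulVec_add, Matrix.mulVec_sub]
    abel
  map_smul' c x := by
    ext i : 1
    simp only [map_smul, Pi.smul_apply, Matrix.mulVec_smul, Matrix.mulVec_sub, smul_add, smul_sub,
      RingHom.id_apply]

theorem mixingMap_apply (Λ : Matrix (Fin p) (Fin p) ℝ) (x : Fin p → Fin n → ℂ) (i : Fin p) :
    mixingMap n Λ x i = ∑ j, (Λ i j : ℂ) • x j := rfl

theorem coupledMap_apply (A K : Matrix (Fin n) (Fin n) ℂ) (Λ : Matrix (Fin p) (Fin p) ℝ)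
    (x : Fin p → Fin n → ℂ) (i : Fin p) :
    coupledMap A K Λ x i = A *ᵥ x i + K *ᵥ (mixingMap n Λ x i - x i) := rfl

theorem mixingMap_mulVec (A : Matrix (Fin n) (Fin n) ℂ) (Λ : Matrix (Fin p) (Fin p) ℝ)
    (x : Fin p → Fin n → ℂ) :
    mixingMap n Λ (fun i => A *ᵥ x i) = fun i => A *ᵥ mixingMap n Λ x i := by
  ext i : 1
  simp [mixingMap_apply, Matrix.mulVec_sum, Matrix.mulVec_smul]

theorem mixingMap_coupledMap (A K : Matrix (Fin n) (Fin n) ℂ) (Λ : Matrix (Fin p) (Fin p) ℝ)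
    (x : Fin p → Fin n → ℂ) :
    mixingMap n Λ (coupledMap A K Λ x) = coupledMap A K Λ (mixingMap n Λ x) := by
  have h : coupledMap A K Λ x =
      (fun i => A *ᵥ x i) + fun i => K *ᵥ (mixingMap n Λ x - x) i := rfl
  rw [h, map_add, mixingMap_mulVec, mixingMap_mulVec, map_sub]
  rfl

/-- The tuples whose weighted mean vanishes. -/
noncomputable def meanZero (n : ℕ) (r : Fin p → ℝ) : Submodule ℂ (Fin p → Fin n → ℂ) where
  carrier := {x | ∑ i, (r i : ℂ) • x i = 0}
  add_mem' {x y} hx hy := by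
    change ∑ i, (r i : ℂ) • (x i + y i) = 0
    simp_rw [smul_add]
    rw [Finset.sum_add_distrib, show ∑ i, (r i : ℂ) • x i = 0 from hx,
      show ∑ i, (r i : ℂ) • y i = 0 from hy, add_zero]
  zero_mem' := by simp
  smul_mem' c x hx := by
    change ∑ i, (r i : ℂ) • c • x i = 0
    simp_rw [smul_comm _ c]
    rw [← Finset.smul_sum, show ∑ i, (r i : ℂ) • x i = 0 from hx, smul_zero]

variable {Λ : Matrix (Fin p) (Fin p) ℝ} {r : Fin p → ℝ}

theorem sum_smul_mixingMap (hr : r ᵥ* Λ = r) (x : Fin p → Fin n → ℂ) :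
    ∑ i, (r i : ℂ) • mixingMap n Λ x i = ∑ i, (r i : ℂ) • x i := by
  simp only [mixingMap_apply, Finset.smul_sum, smul_smul]
  rw [Finset.sum_comm]
  refine Finset.sum_congr rfl fun j _ => ?_
  rw [← Finset.sum_smul]
  congr 1
  have h := congrFun hr j
  simp only [Matrix.vecMul, dotProduct] at h
  exact_mod_cast h

/-- The coupling term leaves the weighted mean alone, which therefore evolves by `A`. -/
theorem sum_smul_coupledMap (hr : r ᵥ* Λ = r) (A K : Matrix (Fin n) (Fin n) ℂ)
    (x : Fin p → Fin n → ℂ) :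
    ∑ i, (r i : ℂ) • coupledMap A K Λ x i = A *ᵥ ∑ i, (r i : ℂ) • x i := by
  have h := sum_smul_mixingMap hr x
  simp only [coupledMap_apply, smul_add, Finset.sum_add_distrib, ← Matrix.mulVec_smul,
    ← Matrix.mulVec_sum, smul_sub, Finset.sum_sub_distrib, h, sub_self, Matrix.mulVec_zero,
    add_zero]

/-- The coupled map commutes with `Λ ⊗ I`, so an eigenvalue of it on the mean-zero tuples has an
eigenvector that is also an eigenvector of `Λ ⊗ I`, for an eigenvalue `ν ≠ 1` of `Λ`. The blocks
of that vector are eigenvectors of `A + (ν - 1) K`. -/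
theorem ConnectedMatrix.norm_lt_one_of_coupledMap_eq_smul (hΛ : ConnectedMatrix Λ)
    (hr : IsNormalizedLeftFixed Λ r) {A K : Matrix (Fin n) (Fin n) ℂ}
    (hstab : ∀ ν μ : ℂ, ‖ν‖ < 1 → ∀ v : Fin n → ℂ, v ≠ 0 →
      A *ᵥ v + (ν - 1) • K *ᵥ v = μ • v → ‖μ‖ < 1)
    {μ : ℂ} {x : Fin p → Fin n → ℂ} (hxr : x ∈ meanZero n r) (hx0 : x ≠ 0)
    (hx : coupledMap A K Λ x = μ • x) : ‖μ‖ < 1 := by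
  let Y : Submodule ℂ (Fin p → Fin n → ℂ) :=
    Module.End.eigenspace (coupledMap A K Λ) μ ⊓ meanZero n r
  have hY : ∀ y ∈ Y, mixingMap n Λ y ∈ Y := by
    rintro y ⟨hy1, hy2⟩
    have hy1 := Module.End.mem_eigenspace_iff.mp hy1
    refine ⟨Module.End.mem_eigenspace_iff.mpr ?_, ?_⟩
    · rw [← mixingMap_coupledMap, hy1, map_smul]
    · exact (sum_smul_mixingMap hr.1 y).trans hy2
  have hxY : x ∈ Y := ⟨Module.End.mem_eigenspace_iff.mpr hx, hxr⟩
  have : Nontrivial Y := ⟨⟨x, hxY⟩, 0, fun h => hx0 (congrArg Subtype.val h)⟩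
  obtain ⟨ν, hν⟩ := Module.End.exists_eigenvalue ((mixingMap n Λ).restrict hY)
  obtain ⟨y, hy⟩ := hν.exists_hasEigenvector
  have hyν : mixingMap n Λ y = ν • (y : Fin p → Fin n → ℂ) := by
    simpa using congrArg Subtype.val hy.apply_eq_smul
  have hy0 : (y : Fin p → Fin n → ℂ) ≠ 0 := fun h => hy.2 (Subtype.ext h)
  have hyμ := Module.End.mem_eigenspace_iff.mp y.2.1
  have hyr : ∑ i, (r i : ℂ) • (y : Fin p → Fin n → ℂ) i = 0 := y.2.2
  generalize (y : Fin p → Fin n → ℂ) = z at hyν hy0 hyμ hyr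
  have hcomp : ∀ a i, ∑ j, (Λ i j : ℂ) * z j a = ν * z i a := fun a i => by
    simpa [mixingMap_apply] using congrFun (congrFun hyν i) a
  obtain ⟨i, hi⟩ := Function.ne_iff.mp hy0
  obtain ⟨a, ha⟩ := Function.ne_iff.mp hi
  have hν1 : ν ≠ 1 := by
    rintro rfl
    have hconst := hΛ.eq_of_fixed (x := fun j => z j a) (fun j => by simpa using hcomp a j) i
    have h := congrFun hyr a
    simp only [Finset.sum_apply, Pi.smul_apply, smul_eq_mul, ← hconst, ← Finset.sum_mul,
      Pi.zero_apply] at h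
    have hr1 : ∑ i, (r i : ℂ) = 1 := by exact_mod_cast hr.2
    rw [hr1, one_mul] at h
    exact ha h
  have hν2 : ‖ν‖ < 1 :=
    hΛ.norm_eigenvalue_lt_one (x := fun j => z j a) (hcomp a) (fun h => ha (congrFun h i)) hν1
  refine hstab ν μ hν2 (z i) hi ?_
  have h := congrFun hyμ i
  rw [coupledMap_apply, hyν] at h
  rw [← Matrix.mulVec_smul, sub_smul, one_smul]
  exact h

end Coupled

theorem Matrix.map_mulVec_ofReal {m n : ℕ} (A : Matrix (Fin m) (Fin n) ℝ) (v : Fin n → ℝ) :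
    A.map (algebraMap ℝ ℂ) *ᵥ (fun i => (v i : ℂ)) = fun i => ((A *ᵥ v) i : ℂ) := by
  ext i
  simp [Matrix.mulVec, dotProduct]

theorem consensusTrajectory_eq {p n : ℕ} (r : Fin p → ℝ) (A : Matrix (Fin n) (Fin n) ℝ)
    (x₀ : Fin p → Fin n → ℝ) (k : ℕ) :
    consensusTrajectory r A x₀ k = (A ^ k) *ᵥ ∑ i, r i • x₀ i := by
  ext a
  simp only [consensusTrajectory, Matrix.mulVec, dotProduct, Fintype.sum_prod_type,
    Matrix.kronecker, Matrix.kroneckerMap_apply, Matrix.replicateRow_apply, Finset.sum_apply,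
    Pi.smul_apply, smul_eq_mul, Finset.mul_sum]
  rw [Finset.sum_comm]
  exact Finset.sum_congr rfl fun _ _ => Finset.sum_congr rfl fun _ _ => by ring

/-- If `A + (ν - 1) L C` is Schur stable for all `ν` in the open unit disc, then `L`
synchronizes the coupled systems for every connected matrix. -/
theorem ConnectedMatrix.synchronizeTo {p n m : ℕ} {Λ : Matrix (Fin p) (Fin p) ℝ}
    (hΛ : ConnectedMatrix Λ) {A : Matrix (Fin n) (Fin n) ℝ} {C : Matrix (Fin m) (Fin n) ℝ}
    {L : Matrix (Fin n) (Fin m) ℝ}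
    (hstab : ∀ ν μ : ℂ, ‖ν‖ < 1 → ∀ v : Fin n → ℂ, v ≠ 0 →
      A.map (algebraMap ℝ ℂ) *ᵥ v + (ν - 1) • (L * C).map (algebraMap ℝ ℂ) *ᵥ v = μ • v → ‖μ‖ < 1)
    {r : Fin p → ℝ} (hr : IsNormalizedLeftFixed Λ r) {x : Fin p → ℕ → Fin n → ℝ}
    (hx : IsSolution A C L Λ x) :
    SynchronizeTo x (consensusTrajectory r A fun i => x i 0) := by
  set M := coupledMap (A.map (algebraMap ℝ ℂ)) ((L * C).map (algebraMap ℝ ℂ)) Λ with hM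
  set c := ∑ i, r i • x i 0 with hc
  have hstep : ∀ i k, x i (k + 1) = A *ᵥ x i k + (L * C) *ᵥ (∑ j, Λ i j • x j k - x i k) := by
    intro i k
    rw [hx i k, couplingSignal, ← Matrix.mulVec_mulVec]
    simp_rw [← Matrix.mulVec_sub, ← Matrix.mulVec_smul]
    rw [← Matrix.mulVec_sum]
    simp_rw [smul_sub]
    rw [Finset.sum_sub_distrib, ← Finset.sum_smul, hΛ.2.2.1 i, one_smul]
  let e : ℕ → Fin p → Fin n → ℂ := fun k i a => ((x i k - (A ^ k) *ᵥ c) a : ℂ)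
  have he : ∀ k, e (k + 1) = M (e k) := by
    intro k
    ext i : 1
    have hmix : mixingMap n Λ (e k) i - e k i =
        fun a => ((∑ j, Λ i j • x j k - x i k) a : ℂ) := by
      have hs : ∑ j, Λ i j • (x j k - (A ^ k) *ᵥ c) - (x i k - (A ^ k) *ᵥ c) =
          ∑ j, Λ i j • x j k - x i k := by
        simp_rw [smul_sub]
        rw [Finset.sum_sub_distrib, ← Finset.sum_smul, hΛ.2.2.1 i, one_smul]
        abel
      rw [← hs]
      ext a
      simp [mixingMap_apply, e]
    rw [hM, coupledMap_apply, hmix, Matrix.map_mulVec_ofReal, Matrix.map_mulVec_ofReal]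
    ext a
    simp only [e, hstep, pow_succ', ← Matrix.mulVec_mulVec, Matrix.mulVec_sub, Pi.add_apply,
      Pi.sub_apply]
    push_cast
    ring
  have he0 : ∀ k, e k = (M ^ k) (e 0) := by
    intro k
    induction k with
    | zero => rfl
    | succ k ih => rw [he, ih, pow_succ', Module.End.mul_apply]
  have hX : ∀ y ∈ meanZero n r, M y ∈ meanZero n r := fun y hy => by
    have hy' : ∑ i, (r i : ℂ) • y i = 0 := hy
    have := sum_smul_coupledMap hr.1 (A.map (algebraMap ℝ ℂ)) ((L * C).map (algebraMap ℝ ℂ)) y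
    rw [hy', Matrix.mulVec_zero] at this
    exact this
  have hmem : e 0 ∈ meanZero n r := by
    change ∑ i, (r i : ℂ) • e 0 i = 0
    have h : ∑ i, r i • (x i 0 - c) = 0 := by
      simp_rw [smul_sub]
      rw [Finset.sum_sub_distrib, ← Finset.sum_smul, hr.2, one_smul, ← hc, sub_self]
    ext a
    have ha := congrFun h a
    simp only [Finset.sum_apply, Pi.smul_apply, smul_eq_mul, Pi.zero_apply, e, pow_zero,
      Matrix.one_mulVec] at ha ⊢
    exact_mod_cast ha
  have hlim := Module.End.tendsto_pow_apply_zero_of_mem M (meanZero n r) hX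
    (fun μ y hy hy0 hyμ => hΛ.norm_lt_one_of_coupledMap_eq_smul hr hstab hy hy0 hyμ) hmem
  simp_rw [← he0] at hlim
  intro i
  have hreal : Tendsto (fun k => x i k - (A ^ k) *ᵥ c) atTop (𝓝 0) := by
    rw [tendsto_pi_nhds] at hlim ⊢
    intro a
    have h := (tendsto_pi_nhds.mp (hlim i)) a
    simpa [e, Function.comp_def] using (Complex.continuous_re.tendsto _).comp h
  have hcont : Continuous fun v : Fin n → ℝ => ‖WithLp.toLp 2 v‖ :=
    continuous_norm.comp (PiLp.continuous_toLp 2 _)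
  have := (hcont.tendsto 0).comp hreal
  simpa [consensusTrajectory_eq, Function.comp_def, ← hc] using this

/-! ### Eigenvalues and invariant splittings -/

section Splitting

variable {n : ℕ} {A : Matrix (Fin n) (Fin n) ℝ}

theorem isEigenvalue_of_mulVec_eq {μ : ℂ} {v : Fin n → ℂ} (hv : v ≠ 0)
    (h : A.map (algebraMap ℝ ℂ) *ᵥ v = μ • v) : IsEigenvalue A μ :=
  Module.End.hasEigenvalue_of_hasEigenvector
    ⟨Module.End.mem_eigenspace_iff.mpr (by rwa [Matrix.toLin'_apply]), hv⟩

theorem isEigenvalue_iff_mem_roots {μ : ℂ} :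
    IsEigenvalue A μ ↔ μ ∈ (A.map (algebraMap ℝ ℂ)).charpoly.roots := by
  rw [IsEigenvalue, Module.End.hasEigenvalue_iff_mem_spectrum, Matrix.spectrum_toLin',
    Matrix.mem_spectrum_iff_isRoot_charpoly,
    Polynomial.mem_roots (Matrix.charpoly_monic _).ne_zero]

theorem norm_eigenvalue_lt_one_of_numUnitEigenvalues_eq_zero (hA : NeutrallyStable A)
    (h0 : numUnitEigenvalues A = 0) {μ : ℂ} (hμ : IsEigenvalue A μ) : ‖μ‖ < 1 := by
  refine lt_of_le_of_ne (hA μ hμ).1 fun h1 => ?_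
  rw [numUnitEigenvalues, Multiset.card_eq_zero, Multiset.filter_eq_nil] at h0
  exact h0 μ (isEigenvalue_iff_mem_roots.mp hμ) h1

theorem numUnitEigenvalues_eq_of_forall (hA : ∀ μ : ℂ, IsEigenvalue A μ → ‖μ‖ = 1) :
    numUnitEigenvalues A = n := by
  rw [numUnitEigenvalues, Multiset.filter_eq_self.mpr
    fun μ hμ => hA μ (isEigenvalue_iff_mem_roots.mpr hμ),
    ← (IsAlgClosed.splits _).natDegree_eq_card_roots, Matrix.charpoly_natDegree_eq_dim,
    Fintype.card_fin]

variable {n₁ n₂ : ℕ} {U : Matrix (Fin n) (Fin n₁) ℝ} {W : Matrix (Fin n) (Fin n₂) ℝ}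
  {F : Matrix (Fin n₁) (Fin n₁) ℝ} {G : Matrix (Fin n₂) (Fin n₂) ℝ}

theorem charpoly_eq_mul_of_similar {V : Matrix (Fin n₁ ⊕ Fin n₂) (Fin n) ℝ}
    (hV : V * Matrix.fromCols U W = 1) (hV' : Matrix.fromCols U W * V = 1)
    (hA : V * A * Matrix.fromCols U W = Matrix.fromBlocks F 0 0 G) :
    A.charpoly = F.charpoly * G.charpoly := by
  have hcard : Fintype.card (Fin n₁ ⊕ Fin n₂) = Fintype.card (Fin n) := by
    have := (Matrix.toLin'OfInv hV hV').finrank_eq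
    simpa using this
  have h := Matrix.charpoly_mul_comm' V (A * Matrix.fromCols U W)
  rw [hcard] at h
  have h' := (Polynomial.isRegular_X_pow _).left.eq_iff.mp h
  rwa [← Matrix.mul_assoc, hA, Matrix.mul_assoc, hV', Matrix.mul_one,
    Matrix.charpoly_fromBlocks_zero₂₁, eq_comm] at h'

theorem IsUnitSplitting.mul_left_block (h : IsUnitSplitting A U W F G) : A * U = U * F := by
  obtain ⟨⟨V, -, hV', hA⟩, -⟩ := h
  have h1 : A * Matrix.fromCols U W = Matrix.fromCols U W * Matrix.fromBlocks F 0 0 G := by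
    rw [← hA, Matrix.mul_assoc V, ← Matrix.mul_assoc, hV', Matrix.one_mul]
  rw [Matrix.mul_fromCols, Matrix.fromCols_mul_fromBlocks] at h1
  simpa using (Matrix.fromCols_inj h1).1

theorem IsUnitSplitting.mul_right_block (h : IsUnitSplitting A U W F G) : A * W = W * G := by
  obtain ⟨⟨V, -, hV', hA⟩, -⟩ := h
  have h1 : A * Matrix.fromCols U W = Matrix.fromCols U W * Matrix.fromBlocks F 0 0 G := by
    rw [← hA, Matrix.mul_assoc V, ← Matrix.mul_assoc, hV', Matrix.one_mul]
  rw [Matrix.mul_fromCols, Matrix.fromCols_mul_fromBlocks] at h1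
  simpa using (Matrix.fromCols_inj h1).2

theorem IsUnitSplitting.numUnitEigenvalues_eq (h : IsUnitSplitting A U W F G) :
    numUnitEigenvalues A = n₁ + numUnitEigenvalues G := by
  obtain ⟨⟨V, hV, hV', hA⟩, hF⟩ := h
  conv_rhs => rw [← numUnitEigenvalues_eq_of_forall hF]
  have h1 := charpoly_eq_mul_of_similar hV hV' hA
  have h2 : (A.map (algebraMap ℝ ℂ)).charpoly =
      (F.map (algebraMap ℝ ℂ)).charpoly * (G.map (algebraMap ℝ ℂ)).charpoly := by
    rw [Matrix.charpoly_map, Matrix.charpoly_map, Matrix.charpoly_map, h1, Polynomial.map_mul]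
  rw [numUnitEigenvalues, h2, Polynomial.roots_mul (mul_ne_zero (Matrix.charpoly_monic _).ne_zero
    (Matrix.charpoly_monic _).ne_zero), Multiset.filter_add, Multiset.card_add]
  rfl

/-- Since `F` already accounts for all eigenvalues of `A` of modulus one, `G` has none. -/
theorem IsUnitSplitting.norm_eigenvalue_lt_one (h : IsUnitSplitting A U W F G)
    (hA : NeutrallyStable A) (hn₁ : n₁ = numUnitEigenvalues A) {μ : ℂ} (hμ : IsEigenvalue G μ) :
    ‖μ‖ < 1 := by
  have hG0 : numUnitEigenvalues G = 0 := by
    have := h.numUnitEigenvalues_eq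
    omega
  have hAμ : IsEigenvalue A μ := by
    obtain ⟨⟨V, hV, hV', hAV⟩, -⟩ := h
    rw [isEigenvalue_iff_mem_roots, Matrix.charpoly_map, charpoly_eq_mul_of_similar hV hV' hAV,
      Polynomial.map_mul, ← Matrix.charpoly_map, ← Matrix.charpoly_map,
      Polynomial.roots_mul (mul_ne_zero (Matrix.charpoly_monic _).ne_zero
      (Matrix.charpoly_monic _).ne_zero), Multiset.mem_add]
    exact Or.inr (isEigenvalue_iff_mem_roots.mp hμ)
  refine lt_of_le_of_ne (hA μ hAμ).1 fun h1 => ?_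
  rw [numUnitEigenvalues, Multiset.card_eq_zero, Multiset.filter_eq_nil] at hG0
  exact hG0 μ (isEigenvalue_iff_mem_roots.mp hμ) h1

theorem IsUnitSplitting.sum_elim_mulVec_eq_zero (h : IsUnitSplitting A U W F G)
    {a : Fin n₁ → ℂ} {b : Fin n₂ → ℂ}
    (hab : U.map (algebraMap ℝ ℂ) *ᵥ a + W.map (algebraMap ℝ ℂ) *ᵥ b = 0) : a = 0 ∧ b = 0 := by
  obtain ⟨⟨V, hV, -, -⟩, -⟩ := h
  have h1 : V.map (algebraMap ℝ ℂ) *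
      Matrix.fromCols (U.map (algebraMap ℝ ℂ)) (W.map (algebraMap ℝ ℂ)) = 1 := by
    rw [← Matrix.fromCols_map, ← Matrix.map_mul, hV, Matrix.map_one _ (map_zero _) (map_one _)]
  rw [← Matrix.fromCols_mulVec_sumElim] at hab
  have h2 := congrArg (V.map (algebraMap ℝ ℂ) *ᵥ ·) hab
  simp only [Matrix.mulVec_mulVec, h1, Matrix.one_mulVec, Matrix.mulVec_zero] at h2
  exact ⟨funext fun i => congrFun h2 (Sum.inl i), funext fun i => congrFun h2 (Sum.inr i)⟩

theorem IsUnitSplitting.exists_coordinates (h : IsUnitSplitting A U W F G) (v : Fin n → ℂ) :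
    ∃ (a : Fin n₁ → ℂ) (b : Fin n₂ → ℂ),
      v = U.map (algebraMap ℝ ℂ) *ᵥ a + W.map (algebraMap ℝ ℂ) *ᵥ b := by
  obtain ⟨⟨V, -, hV', -⟩, -⟩ := h
  have h1 : Matrix.fromCols (U.map (algebraMap ℝ ℂ)) (W.map (algebraMap ℝ ℂ)) *
      V.map (algebraMap ℝ ℂ) = 1 := by
    rw [← Matrix.fromCols_map, ← Matrix.map_mul, hV', Matrix.map_one _ (map_zero _) (map_one _)]
  refine ⟨fun i => (V.map (algebraMap ℝ ℂ) *ᵥ v) (Sum.inl i),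
    fun i => (V.map (algebraMap ℝ ℂ) *ᵥ v) (Sum.inr i), ?_⟩
  rw [← Matrix.fromCols_mulVec_sumElim]
  have h2 : (Sum.elim (fun i => (V.map (algebraMap ℝ ℂ) *ᵥ v) (Sum.inl i))
      fun i => (V.map (algebraMap ℝ ℂ) *ᵥ v) (Sum.inr i)) = V.map (algebraMap ℝ ℂ) *ᵥ v := by
    ext (i | i) <;> rfl
  rw [h2, Matrix.mulVec_mulVec, h1, Matrix.one_mulVec]

end Splitting

/-! ### Detectability and complex eigenvectors -/

section Complexification

variable {m n : ℕ}

theorem Matrix.re_map_mulVec (M : Matrix (Fin m) (Fin n) ℝ) (v : Fin n → ℂ) (i : Fin m) :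
    ((M.map (algebraMap ℝ ℂ) *ᵥ v) i).re = (M *ᵥ fun j => (v j).re) i := by
  simp [Matrix.mulVec, dotProduct]

theorem Matrix.im_map_mulVec (M : Matrix (Fin m) (Fin n) ℝ) (v : Fin n → ℂ) (i : Fin m) :
    ((M.map (algebraMap ℝ ℂ) *ᵥ v) i).im = (M *ᵥ fun j => (v j).im) i := by
  simp [Matrix.mulVec, dotProduct]

theorem Matrix.map_mulVec_eq_zero_iff {M : Matrix (Fin m) (Fin n) ℝ} {v : Fin n → ℂ} :
    M.map (algebraMap ℝ ℂ) *ᵥ v = 0 ↔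
      (M *ᵥ fun j => (v j).re) = 0 ∧ (M *ᵥ fun j => (v j).im) = 0 := by
  simp only [funext_iff, ← Matrix.re_map_mulVec, ← Matrix.im_map_mulVec, Pi.zero_apply,
    Complex.ext_iff, Complex.zero_re, Complex.zero_im, forall_and]

theorem Matrix.map_pow_mulVec_of_eigenvector {A : Matrix (Fin n) (Fin n) ℝ} {μ : ℂ}
    {v : Fin n → ℂ} (hAv : A.map (algebraMap ℝ ℂ) *ᵥ v = μ • v) (k : ℕ) :
    (A ^ k).map (algebraMap ℝ ℂ) *ᵥ v = μ ^ k • v := by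
  induction k with
  | zero => rw [pow_zero, pow_zero, Matrix.map_one _ (map_zero _) (map_one _), Matrix.one_mulVec,
      one_smul]
  | succ k ih => rw [pow_succ, Matrix.map_mul, ← Matrix.mulVec_mulVec, hAv, Matrix.mulVec_smul, ih,
      smul_smul, pow_succ']

/-- The Hautus test: eigenvectors in the kernel of the output matrix of a detectable pair belong
to eigenvalues in the open unit disc. -/
theorem Detectable.norm_lt_one {A : Matrix (Fin n) (Fin n) ℝ} {C : Matrix (Fin m) (Fin n) ℝ}
    (h : Detectable C A) {μ : ℂ} {v : Fin n → ℂ} (hv : v ≠ 0)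
    (hAv : A.map (algebraMap ℝ ℂ) *ᵥ v = μ • v) (hCv : C.map (algebraMap ℝ ℂ) *ᵥ v = 0) :
    ‖μ‖ < 1 := by
  by_contra! hμ
  have hpow := Matrix.map_pow_mulVec_of_eigenvector hAv
  have hout : ∀ k, (C * A ^ k).map (algebraMap ℝ ℂ) *ᵥ v = 0 := fun k => by
    rw [Matrix.map_mul, ← Matrix.mulVec_mulVec, hpow, Matrix.mulVec_smul, hCv, smul_zero]
  have hre := h _ fun k => (Matrix.map_mulVec_eq_zero_iff.mp (hout k)).1
  have him := h _ fun k => (Matrix.map_mulVec_eq_zero_iff.mp (hout k)).2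
  obtain ⟨a, ha⟩ := Function.ne_iff.mp hv
  have hre' := (tendsto_pi_nhds.mp hre) a
  have him' := (tendsto_pi_nhds.mp him) a
  simp_rw [← Matrix.re_map_mulVec, hpow, Pi.zero_apply] at hre'
  simp_rw [← Matrix.im_map_mulVec, hpow, Pi.zero_apply] at him'
  have hsq := (hre'.mul hre').add (him'.mul him')
  simp_rw [← Complex.normSq_apply] at hsq
  have hle : Complex.normSq (v a) ≤ 0 * 0 + 0 * 0 := by
    refine ge_of_tendsto' hsq fun k => ?_
    rw [Pi.smul_apply, smul_eq_mul, map_mul, map_pow, Complex.normSq_eq_norm_sq μ]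
    refine le_mul_of_one_le_left (Complex.normSq_nonneg _) ?_
    exact one_le_pow₀ (one_le_pow₀ hμ)
  simp only [mul_zero, add_zero] at hle
  exact ha (Complex.normSq_eq_zero.mp (le_antisymm hle (Complex.normSq_nonneg _)))

end Complexification

/-! ### The energy identity -/

theorem star_dotProduct_self_eq_sum {ι : Type*} [Fintype ι] (v : ι → ℂ) :
    star v ⬝ᵥ v = ((∑ i, ‖v i‖ ^ 2 : ℝ) : ℂ) := by
  simp [dotProduct, Complex.conj_mul']

theorem star_mulVec_dotProduct_mulVec {ι κ : Type*} [Fintype ι] [Fintype κ] (M : Matrix ι κ ℂ)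
    (v w : κ → ℂ) : star (M *ᵥ v) ⬝ᵥ (M *ᵥ w) = star v ⬝ᵥ ((Mᴴ * M) *ᵥ w) := by
  rw [Matrix.star_mulVec, ← Matrix.dotProduct_mulVec, Matrix.mulVec_mulVec]

/-- In the norm `‖S ξ‖`, which `F` preserves, the map `ξ ↦ F (ξ + (ν - 1) S⁻¹ Hᴴ H S ξ)` lowers the
square of the norm by `(1 - ‖ν‖²) ‖H S ξ‖²`. An eigenvector for an eigenvalue outside the open
unit disc is therefore in the kernel of `H S`. -/
theorem mulVec_eq_zero_of_energy {ι κ : Type*} [Fintype ι] [Fintype κ] [DecidableEq ι]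
    [DecidableEq κ] {F S J : Matrix ι ι ℂ} {H : Matrix κ ι ℂ} (hSJ : S * J = 1)
    (hFS : (S * F)ᴴ * (S * F) = Sᴴ * S) (hH : H * Hᴴ = 1) {ν μ : ℂ} (hν : ‖ν‖ < 1) (hμ : 1 ≤ ‖μ‖)
    {ξ : ι → ℂ} (h : F *ᵥ (ξ + (ν - 1) • (J * Hᴴ * H * S) *ᵥ ξ) = μ • ξ) :
    (H * S) *ᵥ ξ = 0 := by
  set u := ξ + (ν - 1) • (J * Hᴴ * H * S) *ᵥ ξ with hu
  set ζ := S *ᵥ ξ with hζ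
  set y := H *ᵥ ζ with hy
  have hSu : S *ᵥ u = ζ + (ν - 1) • Hᴴ *ᵥ y := by
    rw [hu, Matrix.mulVec_add, Matrix.mulVec_smul, Matrix.mulVec_mulVec, hy, hζ,
      Matrix.mulVec_mulVec, Matrix.mulVec_mulVec]
    simp only [← Matrix.mul_assoc, hSJ, Matrix.one_mul]
  have e1 : star (S *ᵥ u) ⬝ᵥ (S *ᵥ u) = star (μ • ζ) ⬝ᵥ (μ • ζ) := by
    rw [star_mulVec_dotProduct_mulVec, ← hFS, ← star_mulVec_dotProduct_mulVec,
      ← Matrix.mulVec_mulVec, h, Matrix.mulVec_smul]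
  have hcross : star ζ ⬝ᵥ (Hᴴ *ᵥ y) = star y ⬝ᵥ y := by
    rw [hy, star_mulVec_dotProduct_mulVec, Matrix.mulVec_mulVec]
  have hcross' : star (Hᴴ *ᵥ y) ⬝ᵥ ζ = star y ⬝ᵥ y := by
    rw [Matrix.star_mulVec, Matrix.conjTranspose_conjTranspose, ← Matrix.dotProduct_mulVec]
  have hlast : star (Hᴴ *ᵥ y) ⬝ᵥ (Hᴴ *ᵥ y) = star y ⬝ᵥ y := by
    rw [star_mulVec_dotProduct_mulVec, Matrix.conjTranspose_conjTranspose, hH, Matrix.one_mulVec]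
  rw [hSu] at e1
  simp only [star_add, star_smul, add_dotProduct, dotProduct_add, smul_dotProduct, dotProduct_smul,
    hcross, hcross', hlast, star_dotProduct_self_eq_sum, smul_eq_mul] at e1
  set a := ∑ i, ‖ζ i‖ ^ 2 with ha
  set b := ∑ i, ‖y i‖ ^ 2 with hb
  have e2 : a + (‖ν‖ ^ 2 - 1) * b = ‖μ‖ ^ 2 * a := by
    have hν' := Complex.conj_mul' ν
    have hμ' := Complex.conj_mul' μ
    apply Complex.ofReal_injective
    simp only [Complex.star_def, map_sub, map_one] at e1
    push_cast
    linear_combination e1 - (b : ℂ) * hν' + (a : ℂ) * hμ'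
  have ha0 : 0 ≤ a := Finset.sum_nonneg fun i _ => sq_nonneg _
  have hb0 : 0 ≤ b := Finset.sum_nonneg fun i _ => sq_nonneg _
  have hν2 : ‖ν‖ ^ 2 < 1 := by nlinarith [norm_nonneg ν]
  have hμ2 : 1 ≤ ‖μ‖ ^ 2 := one_le_pow₀ hμ
  have hb1 : b = 0 := by
    by_contra hne
    have : 0 < b := lt_of_le_of_ne hb0 (Ne.symm hne)
    nlinarith [mul_le_mul_of_nonneg_right hμ2 ha0]
  rw [← Matrix.mulVec_mulVec, ← hζ, ← hy]
  ext i
  have := (Finset.sum_eq_zero_iff_of_nonneg (fun i _ => sq_nonneg ‖y i‖)).mp hb1 i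
    (Finset.mem_univ i)
  simpa using this

/-! ### Stability of the algorithm's gains -/

theorem Matrix.exists_eq_mul_of_range_le {ι κ l : Type*} [Fintype κ] [Fintype l] [DecidableEq κ]
    {M : Matrix ι κ ℝ} {N : Matrix ι l ℝ}
    (h : LinearMap.range M.mulVecLin ≤ LinearMap.range N.mulVecLin) :
    ∃ Z : Matrix l κ ℝ, M = N * Z := by
  have hcol : ∀ j, ∃ z, N *ᵥ z = M.col j := fun j => by
    obtain ⟨z, hz⟩ := h ⟨Pi.single j 1, rfl⟩
    exact ⟨z, by simpa using hz⟩
  choose z hz using hcol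
  refine ⟨Matrix.of fun i j => z j i, ?_⟩
  ext i j
  have := congrFun (hz j) i
  simpa [Matrix.mul_apply, Matrix.mulVec, dotProduct] using this.symm

theorem Matrix.mulVec_eq_zero_of_rank_mul_eq {l m n : ℕ} {T : Matrix (Fin l) (Fin m) ℝ}
    {B : Matrix (Fin m) (Fin n) ℝ} (h : (T * B).rank = B.rank) {x : Fin n → ℝ}
    (hx : (T * B) *ᵥ x = 0) : B *ᵥ x = 0 := by
  have hle : LinearMap.ker B.mulVecLin ≤ LinearMap.ker (T * B).mulVecLin := fun y hy => by
    rw [LinearMap.mem_ker, Matrix.mulVecLin_apply] at hy ⊢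
    rw [← Matrix.mulVec_mulVec, hy, Matrix.mulVec_zero]
  have h1 := LinearMap.finrank_range_add_finrank_ker B.mulVecLin
  have h2 := LinearMap.finrank_range_add_finrank_ker (T * B).mulVecLin
  have h3 : Module.finrank ℝ (LinearMap.range (T * B).mulVecLin) =
    Module.finrank ℝ (LinearMap.range B.mulVecLin) := h
  have heq := Submodule.eq_of_le_of_finrank_eq hle (by omega)
  have hmem : x ∈ LinearMap.ker B.mulVecLin := heq ▸ LinearMap.mem_ker.mpr hx
  exact hmem

section Gain

variable {n m n₁ n₂ q : ℕ} {A : Matrix (Fin n) (Fin n) ℝ} {C : Matrix (Fin m) (Fin n) ℝ}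
  {U : Matrix (Fin n) (Fin n₁) ℝ} {W : Matrix (Fin n) (Fin n₂) ℝ}
  {F : Matrix (Fin n₁) (Fin n₁) ℝ} {G : Matrix (Fin n₂) (Fin n₂) ℝ}
  {R S : Matrix (Fin n₁) (Fin n₁) ℝ} {H : Matrix (Fin q) (Fin n₁) ℝ}

/-- As `Hᵀ` is an isometry onto the range of the transpose of `C U S⁻¹`, the latter equals
`Q H` with `Q = C U S⁻¹ Hᵀ` invertible. -/
theorem IsOutputBasis.eq_mul {C : Matrix (Fin q) (Fin n) ℝ} (hS : S.PosDef)
    (h : IsOutputBasis C U S H) :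
    C * U * S⁻¹ = C * U * S⁻¹ * Hᵀ * H ∧
      (C * U * S⁻¹ * Hᵀ)⁻¹ * (C * U * S⁻¹ * Hᵀ) = 1 := by
  have hST : S⁻¹ᵀ = S⁻¹ := by
    have := hS.inv.isHermitian.eq
    rwa [Matrix.conjTranspose_eq_transpose_of_trivial] at this
  have hN : S⁻¹ * Uᵀ * Cᵀ = (C * U * S⁻¹)ᵀ := by
    rw [Matrix.transpose_mul, Matrix.transpose_mul, hST, Matrix.mul_assoc]
  obtain ⟨hrange, hH⟩ := h
  rw [hN] at hrange
  set N := C * U * S⁻¹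
  obtain ⟨Z, hZ⟩ := Matrix.exists_eq_mul_of_range_le hrange.ge
  obtain ⟨Y, hY⟩ := Matrix.exists_eq_mul_of_range_le hrange.le
  have hZ' : N = Zᵀ * H := by
    have := congrArg Matrix.transpose hZ
    rwa [Matrix.transpose_transpose, Matrix.transpose_mul, Matrix.transpose_transpose] at this
  have hY' : H = Yᵀ * N := by
    have := congrArg Matrix.transpose hY
    rwa [Matrix.transpose_transpose, Matrix.transpose_mul, Matrix.transpose_transpose] at this
  have hQ : N * Hᵀ = Zᵀ := by rw [hZ', Matrix.mul_assoc, hH, Matrix.mul_one]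
  refine ⟨by rw [hQ]; exact hZ', Matrix.nonsing_inv_mul _ ?_⟩
  refine Matrix.isUnit_det_of_left_inverse (B := Yᵀ) ?_
  rw [← Matrix.mul_assoc, ← hY', hH]

/-- On the neutrally stable part, an eigenvector of `A + (ν - 1) L C` for an eigenvalue outside
the open unit disc has no energy loss; so it is an eigenvector of `A` with zero output, against
detectability. -/
theorem norm_lt_one_of_closedLoop (hA : NeutrallyStable A) (hCA : Detectable C A)
    (hn₁ : n₁ = numUnitEigenvalues A) {T : Matrix (Fin q) (Fin m) ℝ}
    (hU : IsUnitSplitting A U W F G) (hT : (T * C * U).rank = (C * U).rank)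
    (hR : IsInvariantForm F R S) (hH : IsOutputBasis (T * C) U S H)
    {L : Matrix (Fin n) (Fin m) ℝ}
    (hL : L = (U * F * S⁻¹ * Hᵀ * (T * C * U * S⁻¹ * Hᵀ)⁻¹) * T)
    {ν μ : ℂ} (hν : ‖ν‖ < 1) {v : Fin n → ℂ} (hv : v ≠ 0)
    (h : A.map (algebraMap ℝ ℂ) *ᵥ v + (ν - 1) • (L * C).map (algebraMap ℝ ℂ) *ᵥ v = μ • v) :
    ‖μ‖ < 1 := by
  by_contra! hμ
  obtain ⟨-, hFR, hS, hSR⟩ := hR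
  obtain ⟨hN, hQ⟩ := hH.eq_mul hS
  have hSinv : S * S⁻¹ = 1 :=
    Matrix.mul_nonsing_inv _ ((Matrix.isUnit_iff_isUnit_det _).mp hS.isUnit)
  have hSinv' : S⁻¹ * S = 1 :=
    Matrix.nonsing_inv_mul _ ((Matrix.isUnit_iff_isUnit_det _).mp hS.isUnit)
  have hTCU : T * C * U = T * C * U * S⁻¹ * Hᵀ * (H * S) := by
    rw [← Matrix.mul_assoc _ H, ← hN, Matrix.mul_assoc _ S⁻¹, hSinv', Matrix.mul_one]
  set Y := F * S⁻¹ * Hᵀ * (T * C * U * S⁻¹ * Hᵀ)⁻¹ * T * C with hY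
  have hK : L * C = U * Y := by simp only [hL, hY, Matrix.mul_assoc]
  have hYU : Y * U = F * (S⁻¹ * Hᵀ * H * S) := by
    calc Y * U = F * S⁻¹ * Hᵀ * (T * C * U * S⁻¹ * Hᵀ)⁻¹ * (T * C * U) := by
          simp only [hY, Matrix.mul_assoc]
      _ = F * S⁻¹ * Hᵀ * (T * C * U * S⁻¹ * Hᵀ)⁻¹ * (T * C * U * S⁻¹ * Hᵀ * (H * S)) := by
          rw [← hTCU]
      _ = F * S⁻¹ * Hᵀ * ((T * C * U * S⁻¹ * Hᵀ)⁻¹ * (T * C * U * S⁻¹ * Hᵀ)) * (H * S) := by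
          simp only [Matrix.mul_assoc]
      _ = F * (S⁻¹ * Hᵀ * H * S) := by
          rw [hQ]
          simp only [Matrix.mul_assoc, Matrix.one_mul]
  obtain ⟨ξ, η, hvξ⟩ := hU.exists_coordinates v
  have hAU : A.map (algebraMap ℝ ℂ) * U.map (algebraMap ℝ ℂ) =
      U.map (algebraMap ℝ ℂ) * F.map (algebraMap ℝ ℂ) := by
    rw [← Matrix.map_mul, hU.mul_left_block, Matrix.map_mul]
  have hAW : A.map (algebraMap ℝ ℂ) * W.map (algebraMap ℝ ℂ) =
      W.map (algebraMap ℝ ℂ) * G.map (algebraMap ℝ ℂ) := by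
    rw [← Matrix.map_mul, hU.mul_right_block, Matrix.map_mul]
  have hblocks :
      (F.map (algebraMap ℝ ℂ) *ᵥ ξ + (ν - 1) • Y.map (algebraMap ℝ ℂ) *ᵥ v - μ • ξ = 0) ∧
      (G.map (algebraMap ℝ ℂ) *ᵥ η - μ • η = 0) := by
    refine hU.sum_elim_mulVec_eq_zero ?_
    have hAv : A.map (algebraMap ℝ ℂ) *ᵥ v =
        U.map (algebraMap ℝ ℂ) *ᵥ (F.map (algebraMap ℝ ℂ) *ᵥ ξ) +
          W.map (algebraMap ℝ ℂ) *ᵥ (G.map (algebraMap ℝ ℂ) *ᵥ η) := by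
      rw [hvξ, Matrix.mulVec_add]
      simp only [Matrix.mulVec_mulVec, hAU, hAW]
    have hKv : (L * C).map (algebraMap ℝ ℂ) *ᵥ v =
        U.map (algebraMap ℝ ℂ) *ᵥ (Y.map (algebraMap ℝ ℂ) *ᵥ v) := by
      rw [hK, Matrix.map_mul, Matrix.mulVec_mulVec]
    have hμv : μ • v = μ • (U.map (algebraMap ℝ ℂ) *ᵥ ξ) + μ • (W.map (algebraMap ℝ ℂ) *ᵥ η) := by
      rw [hvξ, smul_add]
    rw [hAv, hKv, hμv] at h
    simp only [Matrix.mulVec_sub, Matrix.mulVec_add, Matrix.mulVec_smul]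
    rw [← sub_eq_zero] at h
    rw [← h]
    abel
  have hη : η = 0 := by
    by_contra hη
    exact absurd (hU.norm_eigenvalue_lt_one hA hn₁
      (isEigenvalue_of_mulVec_eq hη (sub_eq_zero.mp hblocks.2))) (not_lt.mpr hμ)
  rw [hη, Matrix.mulVec_zero, add_zero] at hvξ
  have hYv : Y.map (algebraMap ℝ ℂ) *ᵥ v = F.map (algebraMap ℝ ℂ) *ᵥ
      ((S⁻¹ * Hᵀ * H * S).map (algebraMap ℝ ℂ) *ᵥ ξ) := by
    rw [hvξ, Matrix.mulVec_mulVec, Matrix.mulVec_mulVec, ← Matrix.map_mul, ← Matrix.map_mul, hYU]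
  have hct : ∀ {a b : ℕ} (M : Matrix (Fin a) (Fin b) ℝ),
      (M.map (algebraMap ℝ ℂ))ᴴ = Mᵀ.map (algebraMap ℝ ℂ) := fun M => by
    ext i j
    simp
  have hHS : (H * S).map (algebraMap ℝ ℂ) *ᵥ ξ = 0 := by
    rw [Matrix.map_mul]
    have hST : Sᵀ = S := by
      have := hS.isHermitian.eq
      rwa [Matrix.conjTranspose_eq_transpose_of_trivial] at this
    refine mulVec_eq_zero_of_energy (F := F.map (algebraMap ℝ ℂ)) (J := S⁻¹.map (algebraMap ℝ ℂ))
      (ν := ν) (μ := μ) ?_ ?_ ?_ hν hμ ?_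
    · rw [← Matrix.map_mul, hSinv, Matrix.map_one _ (map_zero _) (map_one _)]
    · rw [← Matrix.map_mul, hct, hct, ← Matrix.map_mul, ← Matrix.map_mul, hST, hSR,
        Matrix.transpose_mul, hST, Matrix.mul_assoc, ← Matrix.mul_assoc S, hSR, ← Matrix.mul_assoc,
        hFR]
    · rw [hct, ← Matrix.map_mul, hH.2, Matrix.map_one _ (map_zero _) (map_one _)]
    · rw [hct, ← Matrix.map_mul, ← Matrix.map_mul, ← Matrix.map_mul, Matrix.mulVec_add,
        Matrix.mulVec_smul, ← hYv]
      exact sub_eq_zero.mp hblocks.1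
  have hFξ : F.map (algebraMap ℝ ℂ) *ᵥ ξ = μ • ξ := by
    have h0 : (S⁻¹ * Hᵀ * H * S).map (algebraMap ℝ ℂ) *ᵥ ξ = 0 := by
      rw [Matrix.mul_assoc _ H, Matrix.map_mul, ← Matrix.mulVec_mulVec, hHS, Matrix.mulVec_zero]
    have h1 := sub_eq_zero.mp hblocks.1
    rwa [hYv, h0, Matrix.mulVec_zero, smul_zero, add_zero] at h1
  have hAv : A.map (algebraMap ℝ ℂ) *ᵥ v = μ • v := by
    rw [hvξ, Matrix.mulVec_mulVec, hAU, ← Matrix.mulVec_mulVec, hFξ, Matrix.mulVec_smul]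
  have hTv : (T * (C * U)).map (algebraMap ℝ ℂ) *ᵥ ξ = 0 := by
    rw [← Matrix.mul_assoc, hTCU, Matrix.map_mul, ← Matrix.mulVec_mulVec, hHS, Matrix.mulVec_zero]
  have hCv : C.map (algebraMap ℝ ℂ) *ᵥ v = 0 := by
    rw [hvξ, Matrix.mulVec_mulVec, ← Matrix.map_mul]
    rw [Matrix.mul_assoc] at hT
    rw [Matrix.map_mulVec_eq_zero_iff] at hTv ⊢
    exact ⟨Matrix.mulVec_eq_zero_of_rank_mul_eq hT hTv.1,
      Matrix.mulVec_eq_zero_of_rank_mul_eq hT hTv.2⟩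
  exact absurd (hCA.norm_lt_one hv hAv hCv) (not_lt.mpr hμ)

theorem IsAlgorithmGain.norm_lt_one (hA : NeutrallyStable A) (hCA : Detectable C A)
    {L : Matrix (Fin n) (Fin m) ℝ} (hL : IsAlgorithmGain A C L) (ν μ : ℂ) (hν : ‖ν‖ < 1)
    (v : Fin n → ℂ) (hv : v ≠ 0)
    (h : A.map (algebraMap ℝ ℂ) *ᵥ v + (ν - 1) • (L * C).map (algebraMap ℝ ℂ) *ᵥ v = μ • v) :
    ‖μ‖ < 1 := by
  rcases hL with ⟨h0, rfl⟩ | ⟨-, U, W, F, G, q, T, R, S, H, hU, hT, hCU, hR, hH, hL⟩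
  · refine norm_eigenvalue_lt_one_of_numUnitEigenvalues_eq_zero hA h0
      (isEigenvalue_of_mulVec_eq hv ?_)
    simpa using h
  · exact norm_lt_one_of_closedLoop hA hCA rfl hU (hT.trans hCU.symm) hR hH hL hν hv h

end Gain

/-! ### Real factorization along the unit circle -/

/-- Two complex roots of an irreducible real polynomial are equal or conjugate. -/
theorem Irreducible.norm_eq_of_aeval_eq_zero {g : Polynomial ℝ} (hg : Irreducible g) {z w : ℂ}
    (hz : Polynomial.aeval z g = 0) (hw : Polynomial.aeval w g = 0) : ‖w‖ = ‖z‖ := by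
  set t : Polynomial ℝ := Polynomial.X ^ 2 - Polynomial.C (2 * z.re) * Polynomial.X +
    Polynomial.C (‖z‖ ^ 2) with ht
  have hval : ∀ u : ℂ, Polynomial.aeval u t = (u - z) * (u - (starRingEnd ℂ) z) := fun u => by
    have h1 := Complex.add_conj z
    have h2 := Complex.mul_conj' z
    simp only [ht, map_add, map_sub, map_mul, map_pow, Polynomial.aeval_X, Polynomial.aeval_C,
      Complex.coe_algebraMap]
    push_cast at h1 ⊢
    linear_combination u * h1 - h2
  have hdvd : g ∣ t := by
    have h1 : minpoly ℝ z ∣ t := minpoly.dvd ℝ z (by rw [hval, sub_self, zero_mul])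
    rw [← minpoly.eq_of_irreducible hg hz] at h1
    exact (Dvd.intro _ rfl).trans h1
  have hwt : Polynomial.aeval w t = 0 := by
    obtain ⟨s, hs⟩ := hdvd
    rw [hs, map_mul, hw, zero_mul]
  rw [hval] at hwt
  rcases mul_eq_zero.mp hwt with h | h
  · rw [sub_eq_zero.mp h]
  · rw [sub_eq_zero.mp h, Complex.norm_conj]

theorem Polynomial.exists_unitCircle_factorization (f : Polynomial ℝ) (hf : f ≠ 0) :
    ∃ a b : Polynomial ℝ, f = a * b ∧ (∀ z : ℂ, Polynomial.aeval z a = 0 → ‖z‖ = 1) ∧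
      ∀ z : ℂ, Polynomial.aeval z b = 0 → ‖z‖ ≠ 1 := by
  induction f using WfDvdMonoid.induction_on_irreducible with
  | zero => exact absurd rfl hf
  | unit u hu =>
    obtain ⟨c, hc, rfl⟩ := Polynomial.isUnit_iff.mp hu
    refine ⟨Polynomial.C c, 1, (mul_one _).symm, fun z hz => ?_, fun z hz => ?_⟩
    · exact absurd hz (by simpa using hc.ne_zero)
    · exact absurd hz (by simp)
  | mul f g hf0 hg ih =>
    obtain ⟨a, b, rfl, ha, hb⟩ := ih hf0
    by_cases h : ∃ z : ℂ, Polynomial.aeval z g = 0 ∧ ‖z‖ = 1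
    · obtain ⟨z, hz, hz1⟩ := h
      refine ⟨g * a, b, by ring, fun w hw => ?_, hb⟩
      rw [map_mul] at hw
      rcases mul_eq_zero.mp hw with h | h
      · rw [hg.norm_eq_of_aeval_eq_zero hz h, hz1]
      · exact ha w h
    · push Not at h
      refine ⟨a, g * b, by ring, ha, fun w hw => ?_⟩
      rw [map_mul] at hw
      rcases mul_eq_zero.mp hw with h' | h'
      · exact h w h'
      · exact hb w h'

/-! ### The splitting exists -/

theorem IsEigenvalue.exists_eigenvector {n : ℕ} {A : Matrix (Fin n) (Fin n) ℝ} {μ : ℂ}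
    (h : IsEigenvalue A μ) : ∃ v : Fin n → ℂ, v ≠ 0 ∧ A.map (algebraMap ℝ ℂ) *ᵥ v = μ • v := by
  obtain ⟨v, hv⟩ := Module.End.HasEigenvalue.exists_hasEigenvector h
  exact ⟨v, hv.2, by simpa using hv.apply_eq_smul⟩

theorem IsEigenvalue.aeval_eq_zero {n : ℕ} {A : Matrix (Fin n) (Fin n) ℝ} {μ : ℂ}
    (h : IsEigenvalue A μ) {a : Polynomial ℝ} (ha : Polynomial.aeval A a = 0) :
    Polynomial.aeval μ a = 0 := by
  obtain ⟨v, hv, hAv⟩ := h.exists_eigenvector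
  have key : (Polynomial.aeval A a).map (algebraMap ℝ ℂ) *ᵥ v = Polynomial.aeval μ a • v := by
    have hmap : (Polynomial.aeval A a).map (algebraMap ℝ ℂ) =
        ∑ i ∈ Finset.range (a.natDegree + 1),
          (a.coeff i : ℂ) • (A ^ i).map (algebraMap ℝ ℂ) := by
      rw [Polynomial.aeval_eq_sum_range]
      ext j k
      simp [Matrix.sum_apply]
    rw [hmap, Matrix.sum_mulVec, Polynomial.aeval_eq_sum_range, Finset.sum_smul]
    refine Finset.sum_congr rfl fun i _ => ?_
    rw [Matrix.smul_mulVec, Matrix.map_pow_mulVec_of_eigenvector hAv, smul_smul]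
    rfl
  rw [ha, Matrix.map_zero _ (map_zero _), Matrix.zero_mulVec] at key
  exact (smul_eq_zero.mp key.symm).resolve_right hv

theorem Matrix.mul_eq_mul_toMatrix_restrict {n k : ℕ} {A : Matrix (Fin n) (Fin n) ℝ}
    {E : Submodule ℝ (Fin n → ℝ)} (b : Module.Basis (Fin k) ℝ E)
    (hE : ∀ x ∈ E, Matrix.toLin' A x ∈ E) :
    A * Matrix.of (fun i j => (b j : Fin n → ℝ) i) =
      Matrix.of (fun i j => (b j : Fin n → ℝ) i) *
        LinearMap.toMatrixAlgEquiv b ((Matrix.toLin' A).restrict hE) := by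
  ext i j
  have h := congrArg (fun x : E => (x : Fin n → ℝ) i)
    (b.sum_repr ((Matrix.toLin' A).restrict hE (b j)))
  simp only [Submodule.coe_sum, Submodule.coe_smul, Finset.sum_apply, Pi.smul_apply, smul_eq_mul,
    LinearMap.coe_restrict_apply, Matrix.toLin'_apply] at h
  have h' : (A * Matrix.of (fun i j => (b j : Fin n → ℝ) i)) i j =
      (A *ᵥ (b j : Fin n → ℝ)) i := rfl
  rw [h', ← h, Matrix.mul_apply]
  refine Finset.sum_congr rfl fun l _ => ?_
  rw [LinearMap.toMatrixAlgEquiv_apply, Matrix.of_apply, mul_comm]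

theorem Polynomial.aeval_toMatrixAlgEquiv_restrict {n k : ℕ} {φ : Module.End ℝ (Fin n → ℝ)}
    {a : Polynomial ℝ} {E : Submodule ℝ (Fin n → ℝ)} (b : Module.Basis (Fin k) ℝ E)
    (hE : ∀ x ∈ E, φ x ∈ E) (ha : E ≤ LinearMap.ker (Polynomial.aeval φ a)) :
    Polynomial.aeval (LinearMap.toMatrixAlgEquiv b (φ.restrict hE)) a = 0 := by
  rw [Polynomial.aeval_algHom_apply]
  convert map_zero (LinearMap.toMatrixAlgEquiv b)
  ext x : 1
  apply Subtype.ext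
  have hpow : ∀ (i : ℕ) (y : E),
      (((φ.restrict hE) ^ i) y : Fin n → ℝ) = (φ ^ i) y := fun i y => by
    rw [Module.End.pow_restrict i hE]
    rfl
  have hx : Polynomial.aeval φ a x = 0 := ha x.2
  rw [Polynomial.aeval_eq_sum_range] at hx ⊢
  simpa [LinearMap.sum_apply, hpow] using hx

/-- The splitting is given by the kernels of `a(A)` and `b(A)`, where `a b` is the factorization
of the characteristic polynomial of `A` into a factor with roots on the unit circle and a factor
with roots off it. -/
theorem exists_isUnitSplitting {n : ℕ} (A : Matrix (Fin n) (Fin n) ℝ) :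
    ∃ (U : Matrix (Fin n) (Fin (numUnitEigenvalues A)) ℝ)
      (W : Matrix (Fin n) (Fin (n - numUnitEigenvalues A)) ℝ)
      (F : Matrix (Fin (numUnitEigenvalues A)) (Fin (numUnitEigenvalues A)) ℝ)
      (G : Matrix (Fin (n - numUnitEigenvalues A)) (Fin (n - numUnitEigenvalues A)) ℝ),
      IsUnitSplitting A U W F G := by
  suffices H : ∃ (n₁ n₂ : ℕ) (U : Matrix (Fin n) (Fin n₁) ℝ) (W : Matrix (Fin n) (Fin n₂) ℝ)
      (F : Matrix (Fin n₁) (Fin n₁) ℝ) (G : Matrix (Fin n₂) (Fin n₂) ℝ),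
      n₁ = numUnitEigenvalues A ∧ n₂ = n - numUnitEigenvalues A ∧ IsUnitSplitting A U W F G by
    obtain ⟨_, _, U, W, F, G, rfl, rfl, h⟩ := H
    exact ⟨U, W, F, G, h⟩
  obtain ⟨a, b, hab, ha, hb⟩ :=
    A.charpoly.exists_unitCircle_factorization (Matrix.charpoly_monic A).ne_zero
  have hcop : IsCoprime a b := by
    rw [Polynomial.isCoprime_iff_aeval_ne_zero_of_isAlgClosed ℝ ℂ]
    intro z
    by_contra! h
    exact hb z h.2 (ha z h.1)
  set φ : Module.End ℝ (Fin n → ℝ) := Matrix.toLin' A with hφ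
  have hchar : Polynomial.aeval φ (a * b) = 0 := by
    rw [← hab]
    have h : Polynomial.aeval (Matrix.toLinAlgEquiv' A) A.charpoly = 0 := by
      rw [Polynomial.aeval_algHom_apply, Matrix.aeval_self_charpoly, map_zero]
    exact h
  have hinv : ∀ c : Polynomial ℝ, ∀ x ∈ LinearMap.ker (Polynomial.aeval φ c),
      φ x ∈ LinearMap.ker (Polynomial.aeval φ c) := fun c x hx => by
    have hcomm : Polynomial.aeval φ c * φ = φ * Polynomial.aeval φ c := by
      simpa using congrArg (Polynomial.aeval φ) (mul_comm c Polynomial.X)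
    rw [LinearMap.mem_ker] at hx ⊢
    rw [← Module.End.mul_apply, hcomm, Module.End.mul_apply, hx, map_zero]
  have hcompl : IsCompl (LinearMap.ker (Polynomial.aeval φ a))
      (LinearMap.ker (Polynomial.aeval φ b)) := by
    refine ⟨Polynomial.disjoint_ker_aeval_of_isCoprime φ hcop, codisjoint_iff.mpr ?_⟩
    rw [Polynomial.sup_ker_aeval_eq_ker_aeval_mul_of_coprime φ hcop, hchar, LinearMap.ker_zero]
  let b₁ := Module.finBasis ℝ (LinearMap.ker (Polynomial.aeval φ a))
  let b₂ := Module.finBasis ℝ (LinearMap.ker (Polynomial.aeval φ b))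
  let B := (b₁.prod b₂).map (Submodule.prodEquivOfIsCompl _ _ hcompl)
  let U : Matrix (Fin n) (Fin _) ℝ := Matrix.of fun i j => (b₁ j : Fin n → ℝ) i
  let W : Matrix (Fin n) (Fin _) ℝ := Matrix.of fun i j => (b₂ j : Fin n → ℝ) i
  let F := LinearMap.toMatrixAlgEquiv b₁ (φ.restrict (hinv a))
  let G := LinearMap.toMatrixAlgEquiv b₂ (φ.restrict (hinv b))
  have hP : (Pi.basisFun ℝ (Fin n)).toMatrix B = Matrix.fromCols U W := by
    ext i (j | j)
    · simp [B, U, Module.Basis.toMatrix_apply]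
    · simp [B, W, Module.Basis.toMatrix_apply]
  have hAU : A * U = U * F := Matrix.mul_eq_mul_toMatrix_restrict b₁ (hinv a)
  have hAW : A * W = W * G := Matrix.mul_eq_mul_toMatrix_restrict b₂ (hinv b)
  have hVP : B.toMatrix (Pi.basisFun ℝ (Fin n)) * Matrix.fromCols U W = 1 := by
    rw [← hP, Module.Basis.toMatrix_mul_toMatrix_flip]
  have hPV : Matrix.fromCols U W * B.toMatrix (Pi.basisFun ℝ (Fin n)) = 1 := by
    rw [← hP, Module.Basis.toMatrix_mul_toMatrix_flip]
  have hsplit : IsUnitSplitting A U W F G := by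
    refine ⟨⟨B.toMatrix (Pi.basisFun ℝ (Fin n)), hVP, hPV, ?_⟩, fun μ hμ => ?_⟩
    · have hAP : A * Matrix.fromCols U W = Matrix.fromCols U W * Matrix.fromBlocks F 0 0 G := by
        rw [Matrix.mul_fromCols, Matrix.fromCols_mul_fromBlocks, hAU, hAW]
        simp
      rw [Matrix.mul_assoc, hAP, ← Matrix.mul_assoc, hVP, Matrix.one_mul]
    · exact ha μ (hμ.aeval_eq_zero (Polynomial.aeval_toMatrixAlgEquiv_restrict b₁ (hinv a) le_rfl))
  have hG : numUnitEigenvalues G = 0 := by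
    rw [numUnitEigenvalues, Multiset.card_eq_zero, Multiset.filter_eq_nil]
    intro μ hμ
    exact hb μ ((isEigenvalue_iff_mem_roots.mpr hμ).aeval_eq_zero
      (Polynomial.aeval_toMatrixAlgEquiv_restrict b₂ (hinv b) le_rfl))
  have hn₁ := hsplit.numUnitEigenvalues_eq
  have hn : Module.finrank ℝ (LinearMap.ker (Polynomial.aeval φ a)) +
      Module.finrank ℝ (LinearMap.ker (Polynomial.aeval φ b)) = n := by
    simpa using Submodule.finrank_add_eq_of_isCompl hcompl
  exact ⟨_, _, U, W, F, G, by omega, by omega, hsplit⟩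

/-! ### Invariant forms -/

theorem Module.End.pow_sub_smul_apply_of_intertwining {K E E' : Type*} [Field K] [AddCommGroup E]
    [Module K E] [AddCommGroup E'] [Module K E'] {f : Module.End K E} {g : Module.End K E'}
    {u : E →ₗ[K] E'} (h : ∀ x, g (u x) = u (f x)) (μ : K) (k : ℕ) (x : E) :
    ((g - μ • 1) ^ k) (u x) = u (((f - μ • 1) ^ k) x) := by
  induction k generalizing x with
  | zero => rfl
  | succ k ih =>
    rw [pow_succ, pow_succ, Module.End.mul_apply, Module.End.mul_apply, ← ih]
    simp [h]

/-- The unit part of a neutrally stable matrix is diagonalizable over `ℂ`: `U` carries its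
generalized eigenvectors to those of `A`, which are eigenvectors. -/
theorem IsUnitSplitting.span_eigenvectors_eq_top {n n₁ n₂ : ℕ} {A : Matrix (Fin n) (Fin n) ℝ}
    {U : Matrix (Fin n) (Fin n₁) ℝ} {W : Matrix (Fin n) (Fin n₂) ℝ}
    {F : Matrix (Fin n₁) (Fin n₁) ℝ} {G : Matrix (Fin n₂) (Fin n₂) ℝ}
    (h : IsUnitSplitting A U W F G) (hA : NeutrallyStable A) :
    ⊤ ≤ Submodule.span ℂ {v : Fin n₁ → ℂ |
      ∃ μ : ℂ, F.map (algebraMap ℝ ℂ) *ᵥ v = μ • v} := by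
  rw [← Module.End.iSup_maxGenEigenspace_eq_top (Matrix.toLin' (F.map (algebraMap ℝ ℂ)))]
  refine iSup_le fun μ v hv => Submodule.subset_span ⟨μ, ?_⟩
  have hinter : ∀ x, Matrix.toLin' (A.map (algebraMap ℝ ℂ))
      (Matrix.toLin' (U.map (algebraMap ℝ ℂ)) x) = Matrix.toLin' (U.map (algebraMap ℝ ℂ))
      (Matrix.toLin' (F.map (algebraMap ℝ ℂ)) x) := fun x => by
    simp only [Matrix.toLin'_apply, Matrix.mulVec_mulVec, ← Matrix.map_mul, h.mul_left_block]
  have hinj : ∀ x, U.map (algebraMap ℝ ℂ) *ᵥ x = 0 → x = 0 := fun x hx =>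
    (h.sum_elim_mulVec_eq_zero (a := x) (b := 0) (by rw [hx, Matrix.mulVec_zero, add_zero])).1
  obtain ⟨k, hk⟩ := (Module.End.mem_maxGenEigenspace _ _ _).mp hv
  by_cases hFμ : IsEigenvalue F μ
  · obtain ⟨w, hw0, hw⟩ := hFμ.exists_eigenvector
    have hAμ : IsEigenvalue A μ := by
      refine isEigenvalue_of_mulVec_eq (fun h0 => hw0 (hinj w h0)) ?_
      have := hinter w
      simp only [Matrix.toLin'_apply] at this
      rw [this, hw, Matrix.mulVec_smul]
    have hmem : Matrix.toLin' (U.map (algebraMap ℝ ℂ)) v ∈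
        Module.End.maxGenEigenspace (Matrix.toLin' (A.map (algebraMap ℝ ℂ))) μ := by
      refine (Module.End.mem_maxGenEigenspace _ _ _).mpr ⟨k, ?_⟩
      rw [Module.End.pow_sub_smul_apply_of_intertwining hinter, hk, map_zero]
    rw [(hA μ hAμ).2 (h.2 μ hFμ), Module.End.mem_eigenspace_iff, hinter, ← map_smul,
      ← sub_eq_zero, ← map_sub] at hmem
    exact sub_eq_zero.mp (hinj _ hmem)
  · have hker : ∀ x, (Matrix.toLin' (F.map (algebraMap ℝ ℂ)) - μ • 1) x = 0 → x = 0 :=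
      fun x hx => by
        by_contra hx0
        exact hFμ (isEigenvalue_of_mulVec_eq hx0 (by simpa [sub_eq_zero] using hx))
    have hv0 : v = 0 := by
      clear hv
      induction k with
      | zero => exact hk
      | succ k ih =>
        rw [pow_succ', Module.End.mul_apply] at hk
        exact ih (hker _ hk)
    rw [hv0, Matrix.mulVec_zero, smul_zero]

/-- The real part of a complex matrix product with a real right factor. -/
theorem Matrix.map_re_mul_map_ofReal {ι κ l : Type*} [Fintype κ] (M : Matrix ι κ ℂ)
    (N : Matrix κ l ℝ) : (M * N.map (algebraMap ℝ ℂ)).map Complex.re = M.map Complex.re * N := by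
  ext i j
  simp [Matrix.mul_apply]

theorem Matrix.map_re_map_ofReal_mul {ι κ l : Type*} [Fintype κ] (N : Matrix ι κ ℝ)
    (M : Matrix κ l ℂ) : (N.map (algebraMap ℝ ℂ) * M).map Complex.re = N * M.map Complex.re := by
  ext i j
  simp [Matrix.mul_apply]

/-- If `K` takes coordinates with respect to a basis of eigenvectors, then `F` preserves the real
part of the Hermitian form `Kᴴ K`. -/
theorem exists_posDef_invariant {n₁ : ℕ} {F : Matrix (Fin n₁) (Fin n₁) ℝ}
    (hspan : ⊤ ≤ Submodule.span ℂ {v : Fin n₁ → ℂ |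
      ∃ μ : ℂ, F.map (algebraMap ℝ ℂ) *ᵥ v = μ • v})
    (hF : ∀ μ : ℂ, IsEigenvalue F μ → ‖μ‖ = 1) :
    ∃ R : Matrix (Fin n₁) (Fin n₁) ℝ, R.PosDef ∧ Fᵀ * R * F = R := by
  obtain ⟨ι, _, b, hb⟩ : ∃ (ι : Type) (_ : Fintype ι) (b : Module.Basis ι ℂ (Fin n₁ → ℂ)),
      ∀ j, ∃ μ : ℂ, F.map (algebraMap ℝ ℂ) *ᵥ b j = μ • b j := by
    have := Module.Finite.finite_basis (Module.Basis.ofSpan hspan)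
    exact ⟨_, Fintype.ofFinite _, Module.Basis.ofSpan hspan,
      fun j => Module.Basis.ofSpan_subset hspan ⟨j, rfl⟩⟩
  classical
  choose μ hμ using hb
  have hμ1 : ∀ j, ‖μ j‖ = 1 := fun j => hF _ (isEigenvalue_of_mulVec_eq (b.ne_zero j) (hμ j))
  let K : Matrix ι (Fin n₁) ℂ := LinearMap.toMatrix' (b.equivFun : (Fin n₁ → ℂ) →ₗ[ℂ] (ι → ℂ))
  have hK : ∀ x, K *ᵥ x = b.equivFun x := fun x => by
    rw [← Matrix.toLin'_apply, Matrix.toLin'_toMatrix']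
    rfl
  have hKF : K * F.map (algebraMap ℝ ℂ) = Matrix.diagonal μ * K := by
    apply Matrix.toLin'.injective
    refine b.ext fun j => ?_
    simp only [Matrix.toLin'_apply, ← Matrix.mulVec_mulVec, hμ, hK, map_smul]
    ext i
    by_cases hij : i = j
    · simp [hij, Matrix.mulVec_diagonal]
    · simp [hij, Matrix.mulVec_diagonal]
  have hinv : (F.map (algebraMap ℝ ℂ))ᴴ * (Kᴴ * K) * F.map (algebraMap ℝ ℂ) = Kᴴ * K := by
    have hD : (Matrix.diagonal μ)ᴴ * Matrix.diagonal μ = 1 := by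
      rw [Matrix.diagonal_conjTranspose, Matrix.diagonal_mul_diagonal, ← Matrix.diagonal_one]
      congr 1
      ext j
      simp [Complex.conj_mul', hμ1]
    calc (F.map (algebraMap ℝ ℂ))ᴴ * (Kᴴ * K) * F.map (algebraMap ℝ ℂ) =
          (K * F.map (algebraMap ℝ ℂ))ᴴ * (K * F.map (algebraMap ℝ ℂ)) := by
          rw [Matrix.conjTranspose_mul]
          simp only [Matrix.mul_assoc]
      _ = Kᴴ * ((Matrix.diagonal μ)ᴴ * Matrix.diagonal μ) * K := by
          rw [hKF, Matrix.conjTranspose_mul]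
          simp only [Matrix.mul_assoc]
      _ = Kᴴ * K := by rw [hD, Matrix.mul_one]
  have hFT : (F.map (algebraMap ℝ ℂ))ᴴ = Fᵀ.map (algebraMap ℝ ℂ) := by
    ext i j
    simp
  refine ⟨(Kᴴ * K).map Complex.re, Matrix.PosDef.of_dotProduct_mulVec_pos ?_ ?_, ?_⟩
  · ext i j
    have h := congrFun (congrFun (Matrix.isHermitian_conjTranspose_mul_self K).eq i) j
    have h' := congrArg Complex.re h
    simpa using h'
  · intro x hx
    have hre : star x ⬝ᵥ ((Kᴴ * K).map Complex.re *ᵥ x) =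
        ∑ i, ‖(K *ᵥ fun j => (x j : ℂ)) i‖ ^ 2 := by
      apply Complex.ofReal_injective
      rw [← star_dotProduct_self_eq_sum, star_mulVec_dotProduct_mulVec]
      have hreal : star (star (fun j => (x j : ℂ)) ⬝ᵥ ((Kᴴ * K) *ᵥ fun j => (x j : ℂ))) =
          star (fun j => (x j : ℂ)) ⬝ᵥ ((Kᴴ * K) *ᵥ fun j => (x j : ℂ)) := by
        rw [← star_mulVec_dotProduct_mulVec, star_dotProduct_self_eq_sum]
        simp
      rw [← Complex.conj_eq_iff_re.mp hreal]
      congr 1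
      simp [dotProduct, Matrix.mulVec]
    rw [hre]
    have hne : (K *ᵥ fun j => (x j : ℂ)) ≠ 0 := by
      rw [hK, Ne, LinearEquiv.map_eq_zero_iff]
      intro h0
      exact hx (funext fun j => by simpa using congrFun h0 j)
    obtain ⟨i, hi⟩ := Function.ne_iff.mp hne
    exact Finset.sum_pos' (fun _ _ => sq_nonneg _)
      ⟨i, Finset.mem_univ i, pow_pos (norm_pos_iff.mpr hi) 2⟩
  · rw [← Matrix.map_re_map_ofReal_mul, ← Matrix.map_re_mul_map_ofReal, ← hFT, hinv]

/-! ### Existence of a gain -/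

open scoped MatrixOrder in
theorem Matrix.PosDef.exists_posDef_sqrt {k : ℕ} {R : Matrix (Fin k) (Fin k) ℝ} (hR : R.PosDef) :
    ∃ S : Matrix (Fin k) (Fin k) ℝ, S.PosDef ∧ S * S = R := by
  have hS : CFC.sqrt R * CFC.sqrt R = R := CFC.sqrt_mul_sqrt_self R hR.posSemidef.nonneg
  refine ⟨CFC.sqrt R, ?_, hS⟩
  rw [(Matrix.nonneg_iff_posSemidef.mp (CFC.sqrt_nonneg R)).posDef_iff_isUnit]
  exact isUnit_of_mul_isUnit_left (hS ▸ hR.isUnit)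

/-- Reduction of the output: an isomorphism from the range of `B` to `ℝ^q`, extended to the whole
space. -/
theorem Matrix.exists_rank_mul_eq {m k : ℕ} (B : Matrix (Fin m) (Fin k) ℝ) :
    ∃ T : Matrix (Fin B.rank) (Fin m) ℝ, (T * B).rank = B.rank := by
  let e : LinearMap.range B.mulVecLin ≃ₗ[ℝ] (Fin B.rank → ℝ) :=
    LinearEquiv.ofFinrankEq _ _ (by rw [Module.finrank_fin_fun]; rfl)
  obtain ⟨g, hg⟩ := LinearMap.exists_extend
    (e : LinearMap.range B.mulVecLin →ₗ[ℝ] (Fin B.rank → ℝ))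
  refine ⟨LinearMap.toMatrix' g, ?_⟩
  have hsurj : LinearMap.range (LinearMap.toMatrix' g * B).mulVecLin = ⊤ := by
    rw [LinearMap.range_eq_top]
    intro y
    obtain ⟨x, hx⟩ := (e.symm y).2
    refine ⟨x, ?_⟩
    have h1 : g (e.symm y : Fin m → ℝ) = y := by
      have := LinearMap.congr_fun hg (e.symm y)
      simpa using this
    rw [Matrix.mulVecLin_apply, ← Matrix.mulVec_mulVec, ← Matrix.toLin'_apply,
      Matrix.toLin'_toMatrix', ← Matrix.mulVecLin_apply, hx, h1]
  rw [Matrix.rank, hsurj, finrank_top, Module.finrank_fin_fun]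

/-- A matrix `N` of full row rank has the rows of `(N Nᵀ)^(-1/2) N` as an orthonormal basis of its
row space. -/
theorem Matrix.exists_orthonormal_rows {q k : ℕ} (N : Matrix (Fin q) (Fin k) ℝ) (hN : N.rank = q) :
    ∃ H : Matrix (Fin q) (Fin k) ℝ,
      LinearMap.range Hᵀ.mulVecLin = LinearMap.range Nᵀ.mulVecLin ∧ H * Hᵀ = 1 := by
  have hinj : Function.Injective fun v : Fin q → ℝ => v ᵥ* N := by
    have hker : LinearMap.ker Nᵀ.mulVecLin = ⊥ := by
      have h1 := LinearMap.finrank_range_add_finrank_ker Nᵀ.mulVecLin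
      have h2 : Module.finrank ℝ (LinearMap.range Nᵀ.mulVecLin) = q :=
        (Matrix.rank_transpose N).trans hN
      rw [Module.finrank_fin_fun] at h1
      exact Submodule.finrank_eq_zero.mp (by omega)
    have := LinearMap.ker_eq_bot.mp hker
    simpa [Function.Injective, Matrix.mulVec_transpose] using this
  have hpos := Matrix.PosDef.mul_conjTranspose_self N hinj
  rw [Matrix.conjTranspose_eq_transpose_of_trivial] at hpos
  obtain ⟨M, hM, hMM⟩ := hpos.exists_posDef_sqrt
  have hMT : Mᵀ = M := by
    have := hM.isHermitian.eq
    rwa [Matrix.conjTranspose_eq_transpose_of_trivial] at this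
  have hdet : IsUnit M.det := (Matrix.isUnit_iff_isUnit_det _).mp hM.isUnit
  have hH : (M⁻¹ * N)ᵀ = Nᵀ * M⁻¹ := by
    rw [Matrix.transpose_mul, Matrix.transpose_nonsing_inv, hMT]
  refine ⟨M⁻¹ * N, le_antisymm ?_ ?_, ?_⟩
  · rw [hH, Matrix.mulVecLin_mul]
    exact LinearMap.range_comp_le_range _ _
  · have h : Nᵀ = (M⁻¹ * N)ᵀ * M := by
      rw [hH, Matrix.mul_assoc, Matrix.nonsing_inv_mul _ hdet, Matrix.mul_one]
    rw [h, Matrix.mulVecLin_mul]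
    exact LinearMap.range_comp_le_range _ _
  · calc M⁻¹ * N * (M⁻¹ * N)ᵀ = M⁻¹ * (N * Nᵀ) * M⁻¹ := by
          rw [hH]
          simp only [Matrix.mul_assoc]
      _ = (M⁻¹ * M) * (M * M⁻¹) := by
          rw [← hMM]
          simp only [Matrix.mul_assoc]
      _ = 1 := by rw [Matrix.nonsing_inv_mul _ hdet, Matrix.mul_nonsing_inv _ hdet, Matrix.one_mul]

theorem exists_isAlgorithmGain {n m : ℕ} {A : Matrix (Fin n) (Fin n) ℝ} (hA : NeutrallyStable A)
    (C : Matrix (Fin m) (Fin n) ℝ) : ∃ L : Matrix (Fin n) (Fin m) ℝ, IsAlgorithmGain A C L := by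
  by_cases h0 : numUnitEigenvalues A = 0
  · exact ⟨0, Or.inl ⟨h0, rfl⟩⟩
  obtain ⟨U, W, F, G, hU⟩ := exists_isUnitSplitting A
  obtain ⟨R, hR, hFR⟩ := exists_posDef_invariant (hU.span_eigenvectors_eq_top hA) hU.2
  obtain ⟨S, hS, hSR⟩ := hR.exists_posDef_sqrt
  obtain ⟨T, hT⟩ := (C * U).exists_rank_mul_eq
  have hdet : IsUnit S⁻¹.det := (Matrix.isUnit_iff_isUnit_det _).mp hS.inv.isUnit
  obtain ⟨H, hH, hHH⟩ := (T * C * U * S⁻¹).exists_orthonormal_rows (by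
    rw [Matrix.rank_mul_eq_left_of_isUnit_det _ _ hdet, Matrix.mul_assoc, hT])
  have hST : S⁻¹ᵀ = S⁻¹ := by
    have := hS.inv.isHermitian.eq
    rwa [Matrix.conjTranspose_eq_transpose_of_trivial] at this
  refine ⟨_, Or.inr ⟨h0, U, W, F, G, (C * U).rank, T, R, S, H, hU, ?_, rfl, ⟨hR, hFR, hS, hSR⟩,
    ⟨?_, hHH⟩, rfl⟩⟩
  · rw [Matrix.mul_assoc, hT]
  · rw [hH, Matrix.transpose_mul, Matrix.transpose_mul, hST, Matrix.mul_assoc]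

theorem theorem2 {n m : ℕ} (A : Matrix (Fin n) (Fin n) ℝ) (C : Matrix (Fin m) (Fin n) ℝ)
    (hA : NeutrallyStable A) (hCA : Detectable C A) :
    (∃ L : Matrix (Fin n) (Fin m) ℝ, IsAlgorithmGain A C L) ∧
    ∀ L : Matrix (Fin n) (Fin m) ℝ, IsAlgorithmGain A C L →
      ∀ (p : ℕ) (Λ : Matrix (Fin p) (Fin p) ℝ), ConnectedMatrix Λ →
        (∃! r : Fin p → ℝ, IsNormalizedLeftFixed Λ r) ∧
        ∀ r : Fin p → ℝ, IsNormalizedLeftFixed Λ r →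
          ∀ x : Fin p → ℕ → Fin n → ℝ, IsSolution A C L Λ x →
            SynchronizeTo x (consensusTrajectory r A (fun i => x i 0)) :=
  ⟨exists_isAlgorithmGain hA C, fun _ hL _ _ hΛ => ⟨hΛ.existsUnique_leftFixed,
    fun _ hr _ hx => hΛ.synchronizeTo (hL.norm_lt_one hA hCA) hr hx⟩⟩
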